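/- **Setting.** Let $V\ge 0$ be a locally integrable potential on $\mathbb R^3$, let $\upsilon$ be a non-negative, symmetric ($\upsilon(-x)=\upsilon(x)$), integrable and bounded function on $\mathbb R^3$, let $N\in\mathbb N$, $\mu\in\mathbb R$, and let $\phi\in L^2(\mathbb R^3;\mathbb C)$ with $\|\phi\|_2=1$ satisfy the Hartree equation $\big(-\Delta+V+N(\upsilon*|\phi|^2)\big)\phi=\mu\phi$. Put $$h(x,y)=\{-\Delta+V(x)+N(\upsilon*|\phi|^2)(x)-\mu\}\,\delta(x-y)+N\phi(x)\upsilon(x-y)\overline{\phi(y)},\qquad f_\phi(x,y)=N\phi(x)\upsilon(x-y)\phi(y),$$ where $h$ is the operator in $L^2(\mathbb R^3)$ defined through its quadratic form on $\mathfrak h^1_V=H^1\cap L^2_V$, and $h^T$ is its transpose (the two variables of the kernel interchanged). Write $\overline A u=\overline{A\overline u}$, $\phi^\perp=\{e\in L^2: e\perp\phi\}$ and $\overline\phi^{\,\perp}=\{\overline e: e\in\phi^\perp\}$. Let $h_\perp$ be the projection of $h$ on $\phi^\perp$, $h^T_\perp$ the projection of $h^T$ on $\overline\phi^{\,\perp}$,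 and $f_{\phi\perp}:\overline\phi^{\,\perp}\to\phi^\perp$, $\overline{f_\phi}_\perp:\phi^\perp\to\overline\phi^{\,\perp}$ the projections of $f_\phi$, $\overline{f_\phi}$. Assume that for some $c>0$ $$h(\overline e,e)-|f_\phi(\overline e,\overline e)|\ \ge\ c\|e\|_2^2\qquad\text{for all } e\in\mathfrak h^1_V,\ e\perp\phi .$$ Let $k$ be a bounded operator on $L^2(\mathbb R^3)$ with $k^T=k$, $k\overline\phi=0$ and $\|k\|_{\rm op}<1$ (so $k:\overline\phi^{\,\perp}\to\phi^\perp$ and $\overline k:\phi^\perp\to\overline\phi^{\,\perp}$) that solves the Riccati equation $h\circ k+k\circ h^T+f_\phi+k\circ\overline{f_\phi}\circ k=0$ on $\phi^\perp$ weakly, that is, $$\int (k h^T_\perp p)\,r+\int (kp)\,(h^T_\perp r)+\int (k\overline{f_\phi}kp)\,r=-\int (f_\phi p)\,r\qquad\text{for all } p,r\in\mathrm{dom}(h^T_\perp).$$ On $\phi^\perp\oplus\overline\phi^{\,\perp}$ define $$W=\begin{pmatrix}1&k\\ \overline k&1\end{pmatrix},\qquad M=\begin{pmatrix}h_\perp&-f_{\phi\perp}\\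 \overline{f_\phi}_\perp&-h^T_\perp\end{pmatrix},\qquad D=\begin{pmatrix}h_\perp+k\circ\overline{f_\phi}_\perp&0\\0&-h^T_\perp-\overline k\circ f_{\phi\perp}\end{pmatrix},$$ where $M$ and $D$ have domain $\mathrm{dom}(h_\perp)\oplus\mathrm{dom}(h^T_\perp)$, and let $h_{\rm ph}=h_\perp+k\circ\overline{f_\phi}_\perp$ on $\phi^\perp$, with domain $\mathrm{dom}(h_\perp)$. **Claim.** 1. $1-k\overline k$ on $\phi^\perp$ and $1-\overline k k$ on $\overline\phi^{\,\perp}$ are boundedly invertible, and so is $W$, with $$W^{-1}=\begin{pmatrix}(1-k\overline k)^{-1}&-k(1-\overline kk)^{-1}\\-\overline k(1-k\overline k)^{-1}&(1-\overline kk)^{-1}\end{pmatrix}.$$ 2. $DW=WM$ as unbounded operators: $Wx\in\mathrm{dom}(D)$ if and only if $x\in\mathrm{dom}(M)$, and then $DWx=WMx$. 3. $\sigma(M)=\sigma(D)=\sigma(h_{\rm ph})\cup\sigma(-h_{\rm ph})$; moreover $\sigma(h_{\rm ph})\subset(0,\infty)$, so the two parts are disjoint. 4. If $\omega$ is an eigenvector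 of $h_{\rm ph}$ with eigenvalue $E$, then $W^{-1}(\omega,0)=(u,-\overline ku)$ with $u=(1-k\overline k)^{-1}\omega$ is an eigenvector of $M$ with eigenvalue $E$, and $W^{-1}(0,\overline\omega)=(-kw,w)$ with $w=(1-\overline kk)^{-1}\overline\omega$ is an eigenvector of $M$ with eigenvalue $-E$. Conversely, every eigenvector of $M$ is of the form $W^{-1}(\omega,0)$ (with eigenvalue $E$) or $W^{-1}(0,\overline\omega)$ (with eigenvalue $-E$) for some eigenvector $\omega$ of $h_{\rm ph}$ with eigenvalue $E$. -/

import Mathlib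

open MeasureTheory
open scoped InnerProductSpace ComplexConjugate

noncomputable section

namespace BoseGas

/-! ### The space `L²(ℝ³; ℂ)`, complex conjugation, transposes -/

/-- Physical space `ℝ³`. -/
abbrev R3 : Type := EuclideanSpace ℝ (Fin 3)

/-- The Hilbert space `L²(ℝ³; ℂ)`. Its Mathlib inner product `⟪a, b⟫` is conjugate-linear in `a`. -/
abbrev L2 : Type := Lp ℂ 2 (volume : Measure R3)

/-- The symmetric pairing `∫ a(x) b(x) dx` (bilinear, no complex conjugation). -/
def pairing (a b : L2) : ℂ := ∫ x, a x * b x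

theorem star_add_L2 (a b : L2) : star (a + b) = star a + star b := by
  apply Lp.ext
  filter_upwards [Lp.coeFn_star (a + b), Lp.coeFn_add a b, Lp.coeFn_star a, Lp.coeFn_star b,
    Lp.coeFn_add (star a) (star b)] with x h1 h2 h3 h4 h5
  rw [h1, h5, Pi.add_apply, h3, h4, Pi.star_apply, h2, Pi.add_apply, star_add]
  rfl

theorem star_smul_L2 (c : ℂ) (a : L2) : star (c • a) = conj c • star a := by
  apply Lp.ext
  filter_upwards [Lp.coeFn_star (c • a), Lp.coeFn_smul c a, Lp.coeFn_star a,
    Lp.coeFn_smul (conj c) (star a)] with x h1 h2 h3 h4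
  simp [h1, h2, h3, h4]

theorem norm_star_L2 (a : L2) : ‖star a‖ = ‖a‖ := by
  rw [Lp.norm_def, Lp.norm_def]
  congr 1
  apply eLpNorm_congr_norm_ae
  filter_upwards [Lp.coeFn_star a] with x h1
  simp [h1]

theorem inner_star_star (a b : L2) : ⟪star a, star b⟫_ℂ = conj ⟪a, b⟫_ℂ := by
  rw [L2.inner_def, L2.inner_def, ← integral_conj]
  apply integral_congr_ae
  filter_upwards [Lp.coeFn_star a, Lp.coeFn_star b] with x h1 h2
  simp [h1, h2]

/-- Complex conjugation `u ↦ ū` on `L²`, as a conjugate-linear bounded map. -/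
def conjL2 : L2 →L⋆[ℂ] L2 :=
  LinearMap.mkContinuous
    { toFun := fun a => star a
      map_add' := star_add_L2
      map_smul' := star_smul_L2 } 1 (fun a => by simp [norm_star_L2])

/-- The operator `Ā`, `Ā u = conj (A ū)`; for an integral operator it has the conjugate kernel. -/
def conjOp (A : L2 →L[ℂ] L2) : L2 →L[ℂ] L2 := conjL2.comp (A.comp conjL2)

/-- The transpose `Aᵀ`, `∫ (A u) w = ∫ u (Aᵀ w)`; for an integral operator it has the kernel with
the two variables interchanged. -/
def transposeOp (A : L2 →L[ℂ] L2) : L2 →L[ℂ] L2 := conjOp (ContinuousLinearMap.adjoint A)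

/-! ### Integral operators with square-integrable kernels -/

theorem kernel_section_bound {K : R3 × R3 → ℂ}
    (hK : MemLp K 2 ((volume : Measure R3).prod volume)) (u : L2) :
    MemLp (fun x => ∫ y, K (x, y) * u y) 2 (volume : Measure R3) ∧
      eLpNorm (fun x => ∫ y, K (x, y) * u y) 2 (volume : Measure R3)
        ≤ eLpNorm K 2 ((volume : Measure R3).prod volume) * eLpNorm u 2 volume := by
  have hmeas : AEStronglyMeasurable (fun x => ∫ y, K (x, y) * u y) (volume : Measure R3) := by
    have : AEStronglyMeasurable (fun z : R3 × R3 => K z * u z.2)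
        ((volume : Measure R3).prod volume) :=
      hK.1.mul ((Lp.aestronglyMeasurable u).comp_snd)
    exact this.integral_prod_right'
  have hpt : ∀ᵐ x ∂(volume : Measure R3), ‖∫ y, K (x, y) * u y‖ₑ ^ (2 : ℝ) ≤
      (∫⁻ y, ‖K (x, y)‖ₑ ^ (2 : ℝ)) * (eLpNorm u 2 volume) ^ (2 : ℝ) := by
    filter_upwards [hK.1.prodMk_left] with x hx
    have h1 : ‖∫ y, K (x, y) * u y‖ₑ ≤ ∫⁻ y, ‖K (x, y)‖ₑ * ‖u y‖ₑ := by
      refine (enorm_integral_le_lintegral_enorm _).trans (le_of_eq ?_)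
      simp [enorm_mul]
    have h2 := ENNReal.lintegral_mul_le_Lp_mul_Lq (volume : Measure R3)
      (p := 2) (q := 2) (by constructor <;> norm_num)
      hx.enorm (Lp.aestronglyMeasurable u).enorm
    have h3 : eLpNorm u 2 volume = (∫⁻ y, ‖u y‖ₑ ^ (2 : ℝ)) ^ (1 / (2 : ℝ)) := by
      rw [eLpNorm_eq_lintegral_rpow_enorm_toReal (by norm_num) (by norm_num)]
      simp
    calc ‖∫ y, K (x, y) * u y‖ₑ ^ (2 : ℝ)
        ≤ ((∫⁻ y, ‖K (x, y)‖ₑ ^ (2 : ℝ)) ^ (1 / (2 : ℝ)) * eLpNorm u 2 volume) ^ (2 : ℝ) := by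
          gcongr
          rw [h3]
          exact h1.trans h2
      _ = _ := by
          rw [ENNReal.mul_rpow_of_nonneg _ _ (by norm_num), ← ENNReal.rpow_mul]
          norm_num
  have hK2 : eLpNorm K 2 ((volume : Measure R3).prod volume) =
      (∫⁻ x, ∫⁻ y, ‖K (x, y)‖ₑ ^ (2 : ℝ)) ^ (1 / (2 : ℝ)) := by
    rw [eLpNorm_eq_lintegral_rpow_enorm_toReal (by norm_num) (by norm_num)]
    rw [lintegral_prod _ (by simpa using hK.1.enorm.pow_const _)]
    simp
  have hb : eLpNorm (fun x => ∫ y, K (x, y) * u y) 2 (volume : Measure R3)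
        ≤ eLpNorm K 2 ((volume : Measure R3).prod volume) * eLpNorm u 2 volume := by
    have hu : eLpNorm u 2 volume ≠ ⊤ := Lp.eLpNorm_ne_top u
    calc eLpNorm (fun x => ∫ y, K (x, y) * u y) 2 (volume : Measure R3)
        = (∫⁻ x, ‖∫ y, K (x, y) * u y‖ₑ ^ (2 : ℝ)) ^ (1 / (2 : ℝ)) := by
          rw [eLpNorm_eq_lintegral_rpow_enorm_toReal (by norm_num) (by norm_num)]
          simp
      _ ≤ (∫⁻ x, (∫⁻ y, ‖K (x, y)‖ₑ ^ (2 : ℝ)) * (eLpNorm u 2 volume) ^ (2 : ℝ))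
            ^ (1 / (2 : ℝ)) := by
          gcongr ?_ ^ _
          exact lintegral_mono_ae hpt
      _ = _ := by
          rw [lintegral_mul_const' _ _ (ENNReal.rpow_ne_top_of_nonneg (by norm_num) hu),
            ENNReal.mul_rpow_of_nonneg _ _ (by norm_num), ← ENNReal.rpow_mul, hK2]
          norm_num
  exact ⟨⟨hmeas, hb.trans_lt (ENNReal.mul_lt_top hK.2 (Lp.eLpNorm_lt_top u))⟩, hb⟩

theorem kernel_section_integrable {K : R3 × R3 → ℂ}
    (hK : MemLp K 2 ((volume : Measure R3).prod volume)) (u : L2) :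
    ∀ᵐ x ∂(volume : Measure R3), Integrable (fun y => K (x, y) * u y) := by
  have h2 : Integrable (fun z : R3 × R3 => ‖K z‖ ^ 2) ((volume : Measure R3).prod volume) :=
    (memLp_two_iff_integrable_sq_norm hK.1).1 hK
  filter_upwards [hK.1.prodMk_left, h2.prod_right_ae] with x hx hx2
  have : MemLp (fun y => K (x, y)) 2 (volume : Measure R3) :=
    (memLp_two_iff_integrable_sq_norm hx).2 hx2
  exact this.integrable_mul (Lp.memLp u)

open Classical in
/-- The Hilbert–Schmidt operator `(K u)(x) = ∫ K(x, y) u(y) dy` with kernel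
`K ∈ L²(ℝ³ × ℝ³)` (the value `0` is a convention for kernels outside `L²(ℝ³ × ℝ³)`). -/
def kernelOp (K : R3 × R3 → ℂ) : L2 →L[ℂ] L2 :=
  if hK : MemLp K 2 ((volume : Measure R3).prod volume) then
    LinearMap.mkContinuous
      { toFun := fun u => (kernel_section_bound hK u).1.toLp _
        map_add' := fun u w => by
          rw [← MemLp.toLp_add]
          apply (MemLp.toLp_eq_toLp_iff _ _).2
          filter_upwards [kernel_section_integrable hK u, kernel_section_integrable hK w]
            with x hu hw
          simp only [Pi.add_apply]
          rw [← integral_add hu hw]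
          apply integral_congr_ae
          filter_upwards [Lp.coeFn_add u w] with y hy
          rw [hy, Pi.add_apply, mul_add]
        map_smul' := fun c u => by
          rw [RingHom.id_apply, ← MemLp.toLp_const_smul]
          apply (MemLp.toLp_eq_toLp_iff _ _).2
          filter_upwards with x
          simp only [Pi.smul_apply, smul_eq_mul]
          rw [← integral_const_mul]
          apply integral_congr_ae
          filter_upwards [Lp.coeFn_smul c u] with y hy
          simp only [hy, Pi.smul_apply, smul_eq_mul]
          ring }
      (eLpNorm K 2 ((volume : Measure R3).prod volume)).toReal
      (fun u => by
        change ‖(kernel_section_bound hK u).1.toLp _‖ ≤ _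
        rw [Lp.norm_toLp, Lp.norm_def, ← ENNReal.toReal_mul]
        exact ENNReal.toReal_mono
          (ENNReal.mul_ne_top hK.2.ne (Lp.eLpNorm_ne_top u)) (kernel_section_bound hK u).2)
  else 0

/-! ### Weak gradients and Schrödinger operators -/

/-- `G = (G₀, G₁, G₂)` is the weak gradient of `u`: `∫ (∂ᵢψ) u = - ∫ ψ Gᵢ` for all test
functions `ψ ∈ C_c^∞(ℝ³)`. Thus `u ∈ H¹(ℝ³)` iff `u` has a weak gradient in `L²`. -/
def IsWeakGradient (u : L2) (G : Fin 3 → L2) : Prop :=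
  ∀ (i : Fin 3) (ψ : R3 → ℝ), ContDiff ℝ (⊤ : ℕ∞) ψ → HasCompactSupport ψ →
    ∫ x, (fderiv ℝ ψ x (EuclideanSpace.single i 1)) • u x = - ∫ x, ψ x • G i x

/-- `u` is in the weighted space `L²_U`, i.e. `√U u ∈ L²`, for a potential `U ≥ 0`. -/
def MemWeighted (U : R3 → ℝ) (u : L2) : Prop :=
  MemLp (fun x => ((√(U x) : ℝ) : ℂ) * u x) 2 (volume : Measure R3)

theorem integrable_test_smul {ψ : R3 → ℝ} (hψ : Continuous ψ) (hc : HasCompactSupport ψ)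
    (u : L2) : Integrable (fun x => ψ x • u x) := by
  have h : MemLp ψ 2 (volume : Measure R3) := hψ.memLp_of_hasCompactSupport hc
  exact memLp_one_iff_integrable.1 ((Lp.memLp u).smul h)

theorem IsWeakGradient.add {u w : L2} {G H : Fin 3 → L2} (hu : IsWeakGradient u G)
    (hw : IsWeakGradient w H) : IsWeakGradient (u + w) (G + H) := by
  intro i ψ hψ hc
  have hd : Continuous fun x => fderiv ℝ ψ x (EuclideanSpace.single i 1) :=
    (hψ.continuous_fderiv (by simp)).clm_apply continuous_const
  have hdc : HasCompactSupport fun x => fderiv ℝ ψ x (EuclideanSpace.single i 1) :=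
    hc.fderiv_apply ℝ _
  have e1 : ∫ x, (fderiv ℝ ψ x (EuclideanSpace.single i 1)) • (u + w : L2) x
      = ∫ x, ((fderiv ℝ ψ x (EuclideanSpace.single i 1)) • u x
        + (fderiv ℝ ψ x (EuclideanSpace.single i 1)) • w x) := by
    apply integral_congr_ae
    filter_upwards [Lp.coeFn_add u w] with x hx
    simp only [hx, Pi.add_apply, smul_add]
  have e2 : ∫ x, ψ x • ((G + H) i) x = ∫ x, (ψ x • G i x + ψ x • H i x) := by
    apply integral_congr_ae
    filter_upwards [Lp.coeFn_add (G i) (H i)] with x hx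
    simp only [Pi.add_apply, hx, smul_add]
  rw [e1, e2, integral_add (integrable_test_smul hd hdc u) (integrable_test_smul hd hdc w),
    integral_add (integrable_test_smul hψ.continuous hc _)
      (integrable_test_smul hψ.continuous hc _), hu i ψ hψ hc, hw i ψ hψ hc]
  ring

theorem IsWeakGradient.smul {u : L2} {G : Fin 3 → L2} (c : ℂ) (hu : IsWeakGradient u G) :
    IsWeakGradient (c • u) (c • G) := by
  intro i ψ hψ hc
  have e1 : ∫ x, (fderiv ℝ ψ x (EuclideanSpace.single i 1)) • (c • u : L2) x
      = ∫ x, c • ((fderiv ℝ ψ x (EuclideanSpace.single i 1)) • u x) := by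
    apply integral_congr_ae
    filter_upwards [Lp.coeFn_smul c u] with x hx
    simp only [hx, Pi.smul_apply]
    rw [smul_comm]
  have e2 : ∫ x, ψ x • ((c • G) i) x = ∫ x, c • (ψ x • G i x) := by
    apply integral_congr_ae
    filter_upwards [Lp.coeFn_smul c (G i)] with x hx
    simp only [Pi.smul_apply, hx]
    rw [smul_comm]
  rw [e1, e2, integral_smul, integral_smul, hu i ψ hψ hc, smul_neg]

theorem MemWeighted.add {U : R3 → ℝ} {u w : L2} (hu : MemWeighted U u) (hw : MemWeighted U w) :
    MemWeighted U (u + w) := by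
  refine (MemLp.add hu hw).ae_eq ?_
  filter_upwards [Lp.coeFn_add u w] with x hx
  rw [hx, Pi.add_apply, Pi.add_apply, mul_add]

theorem MemWeighted.smul {U : R3 → ℝ} {u : L2} (c : ℂ) (hu : MemWeighted U u) :
    MemWeighted U (c • u) := by
  refine (MemLp.const_smul hu c).ae_eq ?_
  filter_upwards [Lp.coeFn_smul c u] with x hx
  simp only [hx, Pi.smul_apply, smul_eq_mul]
  ring

theorem MemWeighted.integrable {U : R3 → ℝ} {u w : L2} (hw : MemWeighted U w)
    (hu : MemWeighted U u) :
    Integrable (fun x => conj (((√(U x) : ℝ) : ℂ) * w x) * (((√(U x) : ℝ) : ℂ) * u x)) := by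
  have h : MemLp (fun x => conj (((√(U x) : ℝ) : ℂ) * w x)) 2 (volume : Measure R3) := hw.star
  exact h.integrable_mul hu

/-- The sesquilinear form `∫ U w̄ u` of a potential `U ≥ 0`. -/
def potentialForm (U : R3 → ℝ) (w u : L2) : ℂ :=
  ∫ x, conj (((√(U x) : ℝ) : ℂ) * w x) * (((√(U x) : ℝ) : ℂ) * u x)

theorem potentialForm_add {U : R3 → ℝ} {w u u' : L2} (hw : MemWeighted U w)
    (hu : MemWeighted U u) (hu' : MemWeighted U u') :
    potentialForm U w (u + u') = potentialForm U w u + potentialForm U w u' := by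
  unfold potentialForm
  rw [← integral_add (hw.integrable hu) (hw.integrable hu')]
  apply integral_congr_ae
  filter_upwards [Lp.coeFn_add u u'] with x hx
  simp only [hx, Pi.add_apply]
  ring

theorem potentialForm_smul {U : R3 → ℝ} {w u : L2} (c : ℂ) :
    potentialForm U w (c • u) = c * potentialForm U w u := by
  unfold potentialForm
  rw [← integral_const_mul]
  apply integral_congr_ae
  filter_upwards [Lp.coeFn_smul c u] with x hx
  simp only [hx, Pi.smul_apply, smul_eq_mul]
  ring

/-- The graph of the operator `-Δ + U` in `L²(ℝ³)` for a potential `U ≥ 0`: the pairs `(u, g)` with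
`u ∈ H¹ ∩ L²_U` and `∫ ∇w̄ · ∇u + ∫ U w̄ u = ∫ w̄ g` for all `w ∈ H¹ ∩ L²_U`. -/
def schrodingerGraph (U : R3 → ℝ) : Submodule ℂ (L2 × L2) where
  carrier := {p | ∃ G, IsWeakGradient p.1 G ∧ MemWeighted U p.1 ∧
    ∀ w H, IsWeakGradient w H → MemWeighted U w →
      ∑ i, ⟪H i, G i⟫_ℂ + potentialForm U w p.1 = ⟪w, p.2⟫_ℂ}
  zero_mem' := by
    refine ⟨0, ?_, ?_, ?_⟩
    · intro i ψ _ _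
      rw [integral_eq_zero_of_ae, integral_eq_zero_of_ae, neg_zero] <;>
        exact Filter.Eventually.of_forall fun x => by simp
    · refine (MemLp.zero : MemLp (0 : R3 → ℂ) 2 volume).ae_eq ?_
      exact Filter.Eventually.of_forall fun x => by simp
    · intro w H _ _
      have := potentialForm_smul (U := U) (w := w) (u := 0) 0
      rw [zero_smul, zero_mul] at this
      simp [this]
  add_mem' := by
    rintro p q ⟨G, hG, hU, h⟩ ⟨G', hG', hU', h'⟩
    refine ⟨G + G', hG.add hG', hU.add hU', fun w H hw hwU => ?_⟩
    have e := congrArg₂ (· + ·) (h w H hw hwU) (h' w H hw hwU)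
    simp only [Prod.fst_add, Prod.snd_add, Pi.add_apply, inner_add_right,
      potentialForm_add hwU hU hU', Finset.sum_add_distrib] at e ⊢
    rw [← e]
    ring
  smul_mem' := by
    rintro c p ⟨G, hG, hU, h⟩
    refine ⟨c • G, hG.smul c, hU.smul c, fun w H hw hwU => ?_⟩
    simp only [Prod.smul_fst, Prod.smul_snd, Pi.smul_apply, inner_smul_right,
      potentialForm_smul, ← Finset.mul_sum, ← mul_add, h w H hw hwU]

/-- The Schrödinger operator `-Δ + U` in `L²(ℝ³)`, `U ≥ 0`, defined by its quadratic form. -/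
def schrodinger (U : R3 → ℝ) : L2 →ₗ.[ℂ] L2 := (schrodingerGraph U).toLinearPMap

/-! ### The one-particle operators of the condensate

`V` is the trapping potential, `v` the two-body potential, `N` the number of particles, `μ` the
chemical potential and `φ` the condensate wave function. -/

/-- `V + N (v ∗ |φ|²)`. -/
def effectivePotential (V v : R3 → ℝ) (N : ℕ) (φ : L2) (x : R3) : ℝ :=
  V x + N * ∫ y, v (x - y) * ‖φ y‖ ^ 2

/-- The Hartree operator `-Δ + V + N (v ∗ |φ|²)`. -/
def hartreeOp (V v : R3 → ℝ) (N : ℕ) (φ : L2) : L2 →ₗ.[ℂ] L2 :=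
  schrodinger (effectivePotential V v N φ)

/-- The kernel `γ(x, y) = φ(x) v(x - y) conj φ(y)`. -/
def gammaKernel (v : R3 → ℝ) (φ : L2) (z : R3 × R3) : ℂ :=
  φ z.1 * (v (z.1 - z.2) : ℂ) * conj (φ z.2)

/-- The kernel `f_φ(x, y) = N φ(x) v(x - y) φ(y)`. -/
def fKernel (v : R3 → ℝ) (N : ℕ) (φ : L2) (z : R3 × R3) : ℂ :=
  N * φ z.1 * (v (z.1 - z.2) : ℂ) * φ z.2

/-- The integral operator `f_φ`. -/
def fOp (v : R3 → ℝ) (N : ℕ) (φ : L2) : L2 →L[ℂ] L2 := kernelOp (fKernel v N φ)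

/-- The integral operator with the complex conjugate kernel of `f_φ`. -/
def fBarOp (v : R3 → ℝ) (N : ℕ) (φ : L2) : L2 →L[ℂ] L2 :=
  kernelOp (fun z => conj (fKernel v N φ z))

/-- `h = -Δ + V + N (v ∗ |φ|²) + N γ - μ`. -/
def hOp (V v : R3 → ℝ) (N : ℕ) (μ : ℝ) (φ : L2) : L2 →ₗ.[ℂ] L2 :=
  (((N : ℂ) • kernelOp (gammaKernel v φ) - (μ : ℂ) • ContinuousLinearMap.id ℂ L2 :
    L2 →L[ℂ] L2) : L2 →ₗ[ℂ] L2) +ᵥ hartreeOp V v N φ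

/-- The transpose `hᵀ = -Δ + V + N (v ∗ |φ|²) + N γᵀ - μ`, `γᵀ(x, y) = γ(y, x)`. -/
def hTOp (V v : R3 → ℝ) (N : ℕ) (μ : ℝ) (φ : L2) : L2 →ₗ.[ℂ] L2 :=
  (((N : ℂ) • kernelOp (fun z => gammaKernel v φ z.swap) -
    (μ : ℂ) • ContinuousLinearMap.id ℂ L2 : L2 →L[ℂ] L2) : L2 →ₗ[ℂ] L2) +ᵥ hartreeOp V v N φ

/-- The value `h(ē, e)` of the quadratic form of `h` at `e ∈ H¹ ∩ L²_V` with weak gradient `G`. -/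
def hForm (V v : R3 → ℝ) (N : ℕ) (μ : ℝ) (φ : L2) (e : L2) (G : Fin 3 → L2) : ℝ :=
  ∑ i, ‖G i‖ ^ 2 + (∫ x, effectivePotential V v N φ x * ‖e x‖ ^ 2)
    + N * RCLike.re ⟪e, kernelOp (gammaKernel v φ) e⟫_ℂ - μ * ‖e‖ ^ 2

/-- The coercivity condition `h(ē, e) - |f_φ(ē, ē)| ≥ c ‖e‖²` for all `e ∈ H¹ ∩ L²_V` with
`e ⊥ φ`, where `f_φ(ē, ē) = ∫∫ ē(x) f_φ(x, y) ē(y) dx dy`. -/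
def IsCoerciveWith (V v : R3 → ℝ) (N : ℕ) (μ : ℝ) (φ : L2) (c : ℝ) : Prop :=
  ∀ (e : L2) (G : Fin 3 → L2), IsWeakGradient e G → MemWeighted V e → ⟪φ, e⟫_ℂ = 0 →
    c * ‖e‖ ^ 2 ≤ hForm V v N μ φ e G - ‖pairing (star e) (fOp v N φ (star e))‖

/-! ### Restriction to the orthogonal complement of the condensate -/

/-- The Hilbert space of all `e ∈ L²` that are orthogonal to `φ`. -/
abbrev Perp (φ : L2) : Submodule ℂ L2 := (ℂ ∙ φ)ᗮ

/-- Complex conjugation, as a map from `φ^⊥` to `φ̄^⊥`. -/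
def conjPerp (φ : L2) (e : Perp φ) : Perp (star φ) :=
  ⟨star (e : L2), by
    rw [Submodule.mem_orthogonal_singleton_iff_inner_right, inner_star_star,
      (Submodule.mem_orthogonal_singleton_iff_inner_right).1 e.2, map_zero]⟩

/-- The block `S → T` of a bounded operator: restrict to `S`, project orthogonally onto `T`. -/
def block (S T : Submodule ℂ L2) [T.HasOrthogonalProjection] (A : L2 →L[ℂ] L2) : S →L[ℂ] T :=
  T.orthogonalProjectionOnto ∘L A ∘L S.subtypeL

/-- The projection `e ↦ P_S (A e)`, with domain `dom A ∩ S`, of an unbounded operator on `S`. -/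
def compressPMap (S : Submodule ℂ L2) [S.HasOrthogonalProjection] (A : L2 →ₗ.[ℂ] L2) :
    S →ₗ.[ℂ] S where
  domain := A.domain.comap S.subtype
  toFun :=
    { toFun := fun e => S.orthogonalProjectionOnto (A ⟨(e : S), e.2⟩)
      map_add' := fun a b => by
        rw [← map_add, ← A.map_add]
        rfl
      map_smul' := fun c a => by
        rw [RingHom.id_apply, ← map_smul, ← A.map_smul]
        rfl }

/-- `h_⊥`, the projection of `h` on `φ^⊥`. -/
def hPerp (V v : R3 → ℝ) (N : ℕ) (μ : ℝ) (φ : L2) : Perp φ →ₗ.[ℂ] Perp φ :=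
  compressPMap (Perp φ) (hOp V v N μ φ)

/-- `hᵀ_⊥`, the projection of `hᵀ` on `φ̄^⊥`. -/
def hTPerp (V v : R3 → ℝ) (N : ℕ) (μ : ℝ) (φ : L2) : Perp (star φ) →ₗ.[ℂ] Perp (star φ) :=
  compressPMap (Perp (star φ)) (hTOp V v N μ φ)

/-- `f_φ⊥ : φ̄^⊥ → φ^⊥`. -/
def fPerp (v : R3 → ℝ) (N : ℕ) (φ : L2) : Perp (star φ) →L[ℂ] Perp φ :=
  block (Perp (star φ)) (Perp φ) (fOp v N φ)

/-- `f̄_φ⊥ : φ^⊥ → φ̄^⊥`. -/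
def fBarPerp (v : R3 → ℝ) (N : ℕ) (φ : L2) : Perp φ →L[ℂ] Perp (star φ) :=
  block (Perp φ) (Perp (star φ)) (fBarOp v N φ)

/-- `k` as an operator `φ̄^⊥ → φ^⊥`. -/
def kPerp (φ : L2) (k : L2 →L[ℂ] L2) : Perp (star φ) →L[ℂ] Perp φ :=
  block (Perp (star φ)) (Perp φ) k

/-- `k̄` as an operator `φ^⊥ → φ̄^⊥`. -/
def kBarPerp (φ : L2) (k : L2 →L[ℂ] L2) : Perp φ →L[ℂ] Perp (star φ) :=
  block (Perp φ) (Perp (star φ)) (conjOp k)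

/-- `k` is a weak solution of the Riccati equation
`h ∘ k + k ∘ hᵀ + f_φ + k ∘ f̄_φ ∘ k = 0` on `φ^⊥`, tested against `p, r ∈ dom hᵀ_⊥`. -/
def IsRiccatiSolution (V v : R3 → ℝ) (N : ℕ) (μ : ℝ) (φ : L2) (k : L2 →L[ℂ] L2) : Prop :=
  ∀ p r : (hTPerp V v N μ φ).domain,
    pairing (k (hTPerp V v N μ φ p : L2)) ((r : Perp (star φ)) : L2)
      + pairing (k ((p : Perp (star φ)) : L2)) (hTPerp V v N μ φ r : L2)
      + pairing (k (fBarOp v N φ (k ((p : Perp (star φ)) : L2)))) ((r : Perp (star φ)) : L2)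
    = - pairing (fOp v N φ ((p : Perp (star φ)) : L2)) ((r : Perp (star φ)) : L2)

/-- `h_ph = h + k ∘ f̄_φ` on `φ^⊥`. -/
def hPh (V v : R3 → ℝ) (N : ℕ) (μ : ℝ) (φ : L2) (k : L2 →L[ℂ] L2) : Perp φ →ₗ.[ℂ] Perp φ :=
  ((kPerp φ k ∘L fBarPerp v N φ : Perp φ →L[ℂ] Perp φ) : Perp φ →ₗ[ℂ] Perp φ)
    +ᵥ hPerp V v N μ φ

/-- `hᵀ + k̄ ∘ f_φ` on `φ̄^⊥`, the complex conjugate of `h_ph`. -/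
def hPhBar (V v : R3 → ℝ) (N : ℕ) (μ : ℝ) (φ : L2) (k : L2 →L[ℂ] L2) :
    Perp (star φ) →ₗ.[ℂ] Perp (star φ) :=
  ((kBarPerp φ k ∘L fPerp v N φ : Perp (star φ) →L[ℂ] Perp (star φ)) :
    Perp (star φ) →ₗ[ℂ] Perp (star φ)) +ᵥ hTPerp V v N μ φ

/-! ### Block operators and spectra of unbounded operators -/

section Abstract

variable {X Y : Type*} [NormedAddCommGroup X] [NormedSpace ℂ X] [NormedAddCommGroup Y]
  [NormedSpace ℂ Y]

/-- The bounded block operator `[[a, b], [c, d]]` on `X ⊕ Y`. -/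
def blockCLM (a : X →L[ℂ] X) (b : Y →L[ℂ] X) (c : X →L[ℂ] Y) (d : Y →L[ℂ] Y) :
    X × Y →L[ℂ] X × Y :=
  (a.coprod b).prod (c.coprod d)

/-- The block operator `[[A, b], [c, B]]` on `X ⊕ Y` with unbounded diagonal entries `A`, `B`,
bounded off-diagonal entries `b`, `c` and domain `dom A ⊕ dom B`. -/
def blockPMap (A : X →ₗ.[ℂ] X) (b : Y →L[ℂ] X) (c : X →L[ℂ] Y) (B : Y →ₗ.[ℂ] Y) :
    X × Y →ₗ.[ℂ] X × Y where
  domain := A.domain.prod B.domain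
  toFun :=
    { toFun := fun z => (A ⟨(z : X × Y).1, z.2.1⟩ + b (z : X × Y).2,
        c (z : X × Y).1 + B ⟨(z : X × Y).2, z.2.2⟩)
      map_add' := fun z w => by
        have h1 : A ⟨((z + w : A.domain.prod B.domain) : X × Y).1, (z + w).2.1⟩
            = A ⟨(z : X × Y).1, z.2.1⟩ + A ⟨(w : X × Y).1, w.2.1⟩ := by
          rw [← A.map_add]; rfl
        have h2 : B ⟨((z + w : A.domain.prod B.domain) : X × Y).2, (z + w).2.2⟩
            = B ⟨(z : X × Y).2, z.2.2⟩ + B ⟨(w : X × Y).2, w.2.2⟩ := by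
          rw [← B.map_add]; rfl
        rw [h1, h2]
        ext
        · simp only [Submodule.coe_add, Prod.snd_add, map_add, Prod.fst_add]
          abel
        · simp only [Submodule.coe_add, Prod.snd_add, map_add, Prod.fst_add]
          abel
      map_smul' := fun t z => by
        have h1 : A ⟨((t • z : A.domain.prod B.domain) : X × Y).1, (t • z).2.1⟩
            = t • A ⟨(z : X × Y).1, z.2.1⟩ := by
          rw [← A.map_smul]; rfl
        have h2 : B ⟨((t • z : A.domain.prod B.domain) : X × Y).2, (t • z).2.2⟩
            = t • B ⟨(z : X × Y).2, z.2.2⟩ := by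
          rw [← B.map_smul]; rfl
        rw [h1, h2]
        ext
        · simp only [Submodule.coe_smul, Prod.smul_snd, map_smul, Prod.smul_fst, smul_add,
            RingHom.id_apply]
        · simp only [Submodule.coe_smul, Prod.smul_snd, map_smul, Prod.smul_fst, smul_add,
            RingHom.id_apply] }

/-- `R` is a bounded two-sided inverse of `A - z : dom A → X`. -/
def IsResolventAt (A : X →ₗ.[ℂ] X) (z : ℂ) (R : X →L[ℂ] X) : Prop :=
  (∀ x : X, ∃ hx : R x ∈ A.domain, A ⟨R x, hx⟩ - z • R x = x) ∧
    ∀ x : A.domain, R (A x - z • (x : X)) = x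

/-- The spectrum of an unbounded operator: all `z` such that `A - z : dom A → X` has no bounded
two-sided inverse. -/
def pmapSpectrum (A : X →ₗ.[ℂ] X) : Set ℂ := {z | ¬ ∃ R, IsResolventAt A z R}

/-- `x` is an eigenvector of the unbounded operator `A` with eigenvalue `z`. -/
def IsEigenvector (A : X →ₗ.[ℂ] X) (z : ℂ) (x : X) : Prop :=
  x ≠ 0 ∧ ∃ hx : x ∈ A.domain, A ⟨x, hx⟩ = z • x

end Abstract

/-! ### The operators `M`, `D`, `W` and the inverse of `W` on `φ^⊥ ⊕ φ̄^⊥` -/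

/-- `M = [[h_⊥, -f_φ⊥], [f̄_φ⊥, -hᵀ_⊥]]`. -/
def mOp (V v : R3 → ℝ) (N : ℕ) (μ : ℝ) (φ : L2) :
    Perp φ × Perp (star φ) →ₗ.[ℂ] Perp φ × Perp (star φ) :=
  blockPMap (hPerp V v N μ φ) (-fPerp v N φ) (fBarPerp v N φ) (-hTPerp V v N μ φ)

/-- `D = diag (h_⊥ + k ∘ f̄_φ⊥, -hᵀ_⊥ - k̄ ∘ f_φ⊥)`. -/
def dOp (V v : R3 → ℝ) (N : ℕ) (μ : ℝ) (φ : L2) (k : L2 →L[ℂ] L2) :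
    Perp φ × Perp (star φ) →ₗ.[ℂ] Perp φ × Perp (star φ) :=
  blockPMap (hPh V v N μ φ k) 0 0 (-hPhBar V v N μ φ k)

/-- `W = [[1, k], [k̄, 1]]`. -/
def wOp (φ : L2) (k : L2 →L[ℂ] L2) : Perp φ × Perp (star φ) →L[ℂ] Perp φ × Perp (star φ) :=
  blockCLM 1 (kPerp φ k) (kBarPerp φ k) 1

/-- `(1 - k ∘ k̄)⁻¹` on `φ^⊥` (meaningful when `1 - k ∘ k̄` is invertible). -/
def invKKBar (φ : L2) (k : L2 →L[ℂ] L2) : Perp φ →L[ℂ] Perp φ :=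
  Ring.inverse (1 - kPerp φ k ∘L kBarPerp φ k)

/-- `(1 - k̄ ∘ k)⁻¹` on `φ̄^⊥` (meaningful when `1 - k̄ ∘ k` is invertible). -/
def invKBarK (φ : L2) (k : L2 →L[ℂ] L2) : Perp (star φ) →L[ℂ] Perp (star φ) :=
  Ring.inverse (1 - kBarPerp φ k ∘L kPerp φ k)

/-- `[[(1 - k k̄)⁻¹, -k (1 - k̄ k)⁻¹], [-k̄ (1 - k k̄)⁻¹, (1 - k̄ k)⁻¹]]`. -/
def wInvOp (φ : L2) (k : L2 →L[ℂ] L2) : Perp φ × Perp (star φ) →L[ℂ] Perp φ × Perp (star φ) :=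
  blockCLM (invKKBar φ k) (-(kPerp φ k ∘L invKBarK φ k))
    (-(kBarPerp φ k ∘L invKKBar φ k)) (invKBarK φ k)

end BoseGas

end

/-! Put `A = h_⊥`, `B = hᵀ_⊥`, `f = f_φ⊥`. The symmetry `kᵀ = k` makes `k̄` the adjoint `k'` of `k`,
and the symmetry of `v` makes the conjugate of `f` its adjoint `f'`. The theorem thus reduces to
statements about two self-adjoint operators coupled by bounded maps, `IsPairSystem`, in which the
two sides play the same role (`IsPairSystem.swap`); complex conjugation is needed again only to
compare the two sides.

Diagonalization. Self-adjointness of `A` upgrades the weak Riccati equation: `k` maps `dom B` into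
`dom A`, and the equation holds there strongly (`strong_riccati`). It then says exactly that `D W =
W M` on `dom M` (`dressedPMap_add`, `intertwining`). Invertibility of `W` is a Neumann series, as
`‖k k'‖ < 1`. The delicate point is that `W x ∈ dom D` forces `x ∈ dom M`, that is, that `G = (1 - k
k')⁻¹` preserves `dom A` (`mem_of_sub_mem`). By the Riccati equation the commutator of `A` and `1 -
k k'` is bounded, so `A` conjugated by `1 - k k'` is a bounded perturbation of `A`, and a resolvent
argument applies.

Spectrum. `A + k f'` is in general not self-adjoint, but it is so for the equivalent inner product
`⟪x, G y⟫`. Indeed `⟪y, G (A + k f') x⟫` is the sesquilinear form of the block matrix `[[A, -f],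
[-f', B]]` between the vectors `(G y, -k' G y)` and `(G x, -k' G x)`. This form is symmetric, and it
is bounded below by polarization of the coercivity assumption (`coercive_pair`). So `G (A + k f')`
is self-adjoint and positive, `G` is positive, and `G (A + k f') - z G` is invertible unless `z >
0`. The spectrum of `M` is that of `D` by similarity. The lower block of `D` is minus the complex
conjugate of `h_ph`, whose spectrum is real, so it contributes `σ(-h_ph)`. Eigenvectors are
transported by `W⁻¹`; the signs of the two parts prevent mixing.

The analytic input is self-adjointness of `h_⊥` and `hᵀ_⊥`: the Schrödinger operator is treated by
projection onto its form domain, and the bounded perturbation and the compression to `φ^⊥` preserve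
self-adjointness. -/

noncomputable section

namespace BoseGas

/-! ### Self-adjoint unbounded operators -/

section SelfAdjoint

variable {X : Type*} [NormedAddCommGroup X] [InnerProductSpace ℂ X]

/-- `A` is self-adjoint: it is symmetric and its domain is as large as symmetry allows. -/
structure IsSelfAdjointPMap (A : X →ₗ.[ℂ] X) : Prop where
  symm : ∀ x y : A.domain, ⟪A x, (y : X)⟫_ℂ = ⟪(x : X), A y⟫_ℂ
  maximal : ∀ y z : X, (∀ x : A.domain, ⟪A x, y⟫_ℂ = ⟪(x : X), z⟫_ℂ) →
    ∃ hy : y ∈ A.domain, A ⟨y, hy⟩ = z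

namespace IsSelfAdjointPMap

variable {A : X →ₗ.[ℂ] X}

/-- A symmetric operator `A` with `A + t` onto for some real `t` is self-adjoint. -/
theorem of_surjective (hs : ∀ x y : A.domain, ⟪A x, (y : X)⟫_ℂ = ⟪(x : X), A y⟫_ℂ) (t : ℝ)
    (ht : ∀ z : X, ∃ x : A.domain, A x + (t : ℂ) • (x : X) = z) : IsSelfAdjointPMap A := by
  refine ⟨hs, fun y z h => ?_⟩
  -- By symmetry `y - x₀` is orthogonal to the range of `A + t`, which is everything; expressing `y
  -- - x₀` itself as `(A + t) x₁` gives `y = x₀`.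
  obtain ⟨x₀, hx₀⟩ := ht (z + (t : ℂ) • y)
  obtain ⟨x₁, hx₁⟩ := ht (y - x₀)
  have key : ⟪y - (x₀ : X), y - (x₀ : X)⟫_ℂ = 0 := by
    have e1 : ⟪y - (x₀ : X), y⟫_ℂ = ⟪(x₁ : X), z + (t : ℂ) • y⟫_ℂ := by
      rw [← hx₁, inner_add_left, h, inner_add_right, inner_smul_left, inner_smul_right,
        Complex.conj_ofReal]
    have e2 : ⟪y - (x₀ : X), (x₀ : X)⟫_ℂ = ⟪(x₁ : X), z + (t : ℂ) • y⟫_ℂ := by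
      rw [← hx₁, inner_add_left, hs, ← hx₀, inner_add_right, inner_smul_left, inner_smul_right,
        Complex.conj_ofReal]
    rw [inner_sub_right, e1, e2, sub_self]
  have hy : y = x₀ := sub_eq_zero.1 (inner_self_eq_zero.1 key)
  subst hy
  exact ⟨x₀.2, add_right_cancel hx₀⟩

/-- Density of the domain is hidden in `maximal`: if `z` is orthogonal to the domain, the pair `(0,
z)` passes the test, so `z = A 0`. -/
theorem eq_zero_of_orthogonal (hA : IsSelfAdjointPMap A) {z : X}
    (hz : ∀ x : A.domain, ⟪(x : X), z⟫_ℂ = 0) : z = 0 := by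
  obtain ⟨h0, h⟩ := hA.maximal 0 z (fun x => by rw [inner_zero_right, hz])
  rw [← h]
  exact A.map_zero

/-- A bounded symmetric perturbation of a self-adjoint operator is self-adjoint. -/
theorem vadd (hA : IsSelfAdjointPMap A) (T : X →L[ℂ] X)
    (hT : ∀ x y, ⟪T x, y⟫_ℂ = ⟪x, T y⟫_ℂ) : IsSelfAdjointPMap ((T : X →ₗ[ℂ] X) +ᵥ A) := by
  refine ⟨fun x y => ?_, fun y z h => ?_⟩
  · have := hA.symm x y
    simp only [LinearPMap.vadd_apply, ContinuousLinearMap.coe_coe, inner_add_left,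
      inner_add_right, hT]
    exact congrArg _ this
  · obtain ⟨hy, e⟩ := hA.maximal y (z - T y) (fun x => by
      have := h x
      simp only [LinearPMap.vadd_apply, ContinuousLinearMap.coe_coe, inner_add_left, hT] at this
      rw [inner_sub_right]
      exact eq_sub_of_add_eq' this)
    refine ⟨hy, ?_⟩
    simp only [LinearPMap.vadd_apply, ContinuousLinearMap.coe_coe]
    exact (congrArg (T y + ·) e).trans (add_sub_cancel _ _)

/-- By symmetry and maximality the graph is cut out by the closed conditions `⟪A x, p.1⟫ = ⟪x,
p.2⟫`. -/
theorem isClosed_graph (hA : IsSelfAdjointPMap A) : IsClosed (A.graph : Set (X × X)) := by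
  have : (A.graph : Set (X × X)) = ⋂ x : A.domain, {p | ⟪A x, p.1⟫_ℂ = ⟪(x : X), p.2⟫_ℂ} := by
    ext p
    simp only [SetLike.mem_coe, LinearPMap.mem_graph_iff, Set.mem_iInter, Set.mem_ofPred_eq]
    constructor
    · rintro ⟨y, h1, h2⟩ x
      rw [← h1, ← h2, hA.symm]
    · intro h
      obtain ⟨hy, e⟩ := hA.maximal _ _ h
      exact ⟨⟨_, hy⟩, rfl, e⟩
  rw [this]
  exact isClosed_iInter fun x => isClosed_eq (by fun_prop) (by fun_prop)

/-- If `A - T` and `A - T*` are bounded below, then `A - T` has a bounded inverse. -/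
theorem exists_inverse [CompleteSpace X] (hA : IsSelfAdjointPMap A) (T T' : X →L[ℂ] X)
    (hTT' : ∀ x y, ⟪T x, y⟫_ℂ = ⟪x, T' y⟫_ℂ) {δ : ℝ} (hδ : 0 < δ)
    (h1 : ∀ x : A.domain, δ * ‖(x : X)‖ ≤ ‖A x - T x‖)
    (h2 : ∀ x : A.domain, δ * ‖(x : X)‖ ≤ ‖A x - T' x‖) :
    ∃ R : X →L[ℂ] X, (∀ x, ∃ hx : R x ∈ A.domain, A ⟨R x, hx⟩ - T (R x) = x) ∧
      ∀ x : A.domain, R (A x - T x) = x := by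
  have : CompleteSpace A.graph := hA.isClosed_graph.completeSpace_coe
  -- `A - T` becomes a bounded map once its domain carries the graph norm, and the graph is complete
  -- because it is closed.
  let F : A.graph →L[ℂ] X :=
    (ContinuousLinearMap.snd ℂ X X - T ∘L ContinuousLinearMap.fst ℂ X X) ∘L A.graph.subtypeL
  have hF : ∀ p : A.graph, F p = (p : X × X).2 - T (p : X × X).1 := fun p => rfl
  have hb : ∀ p : A.graph, δ * ‖(p : X × X).1‖ ≤ ‖F p‖ := by
    rintro ⟨p, hp⟩
    obtain ⟨y, e1, e2⟩ := LinearPMap.mem_graph_iff _ |>.1 hp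
    rw [hF, ← e1, ← e2]
    exact h1 y
  -- The graph norm is the larger of `‖x‖ ≤ δ⁻¹ ‖F p‖` and `‖A x‖ ≤ ‖F p‖ + ‖T‖ ‖x‖`; the constant
  -- adds up the two bounds.
  have hanti : ∀ p : A.graph, ‖p‖ ≤ (⟨δ⁻¹ + 1 + ‖T‖ * δ⁻¹, by positivity⟩ : NNReal) * ‖F p‖ := by
    intro p
    have e1 : ‖(p : X × X).1‖ ≤ δ⁻¹ * ‖F p‖ := by
      rw [inv_mul_eq_div, le_div_iff₀ hδ, mul_comm]
      exact hb p
    have e2 : ‖(p : X × X).2‖ ≤ ‖F p‖ + ‖T‖ * (δ⁻¹ * ‖F p‖) := by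
      have : (p : X × X).2 = F p + T (p : X × X).1 := by rw [hF]; abel
      rw [this]
      refine (norm_add_le _ _).trans (add_le_add_right ?_ _)
      exact (T.le_opNorm _).trans (by gcongr)
    have e3 : 0 ≤ ‖T‖ * δ⁻¹ * ‖F p‖ := by positivity
    have e4 : 0 ≤ δ⁻¹ * ‖F p‖ := by positivity
    have e5 := norm_nonneg (F p)
    change ‖(p : X × X)‖ ≤ (δ⁻¹ + 1 + ‖T‖ * δ⁻¹) * ‖F p‖
    rw [Prod.norm_def]
    apply max_le <;> nlinarith
  have hal := F.antilipschitz_of_bound hanti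
  have hcl : IsClosed (Set.range F) := hal.isClosed_range F.uniformContinuous
  have hr : F.range = ⊤ := by
    have : CompleteSpace F.range := by
      apply IsClosed.completeSpace_coe (hs := ?_)
      rw [LinearMap.coe_range]
      exact hcl
    -- The range is closed, so it is enough that nothing is orthogonal to it. An orthogonal `y` lies
    -- in `dom A` and satisfies `A y = T' y`, against the second lower bound unless `y = 0`.
    rw [← Submodule.orthogonal_eq_bot_iff, Submodule.eq_bot_iff]
    intro y hy
    obtain ⟨hyd, hy'⟩ := hA.maximal y (T' y) (fun x => by
      have hx : ((x : X), A x) ∈ A.graph := LinearPMap.mem_graph A x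
      have := (Submodule.mem_orthogonal _ _).1 hy (F ⟨_, hx⟩) ⟨_, rfl⟩
      rw [hF, inner_sub_left, sub_eq_zero, hTT'] at this
      exact this)
    have := h2 ⟨y, hyd⟩
    rw [hy', sub_self, norm_zero] at this
    have h3 : ‖y‖ ≤ 0 := by
      by_contra h
      exact absurd this (not_le.2 (mul_pos hδ (not_le.1 h)))
    exact norm_le_zero_iff.1 h3
  have hk : F.ker = ⊥ := LinearMap.ker_eq_bot.2 hal.injective
  let e := ContinuousLinearEquiv.ofBijective F hk hr
  have he : ∀ p, e p = F p := fun p => rfl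
  refine ⟨ContinuousLinearMap.fst ℂ X X ∘L A.graph.subtypeL ∘L (e.symm : X →L[ℂ] A.graph),
    fun x => ?_, fun x => ?_⟩
  · have h3 := hF (e.symm x)
    rw [← he, e.apply_symm_apply] at h3
    obtain ⟨y, e1, e2⟩ := LinearPMap.mem_graph_iff _ |>.1 (e.symm x).2
    have h4 : (e.symm x : X × X).1 ∈ A.domain := e1 ▸ y.2
    refine ⟨h4, ?_⟩
    have h5 : A ⟨(e.symm x : X × X).1, h4⟩ = (e.symm x : X × X).2 := by
      rw [← e2]
      congr 1
      exact Subtype.ext e1.symm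
    change A ⟨(e.symm x : X × X).1, h4⟩ - T (e.symm x : X × X).1 = x
    rw [h5, ← h3]
  · have hx : ((x : X), A x) ∈ A.graph := LinearPMap.mem_graph A x
    have : A x - T x = e ⟨_, hx⟩ := rfl
    change ((e.symm (A x - T x) : A.graph) : X × X).1 = x
    rw [this, e.symm_apply_apply]

end IsSelfAdjointPMap

end SelfAdjoint

/-! ### Spectra of unbounded operators -/

section Spectrum

variable {X Y : Type*} [NormedAddCommGroup X] [NormedSpace ℂ X] [NormedAddCommGroup Y]
  [NormedSpace ℂ Y]

theorem IsResolventAt.neg {A : X →ₗ.[ℂ] X} {z : ℂ} {R : X →L[ℂ] X} (h : IsResolventAt A z R) :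
    IsResolventAt (-A) (-z) (-R) := by
  refine ⟨fun x => ?_, fun x => ?_⟩
  · obtain ⟨hx, e⟩ := h.1 x
    have hx' : -(R x) ∈ A.domain := neg_mem hx
    refine ⟨hx', ?_⟩
    have e1 : A ⟨-(R x), hx'⟩ = -A ⟨R x, hx⟩ := A.map_neg ⟨R x, hx⟩
    change -A ⟨-(R x), hx'⟩ - (-z) • -(R x) = x
    rw [e1, neg_neg, neg_smul, smul_neg, neg_neg, e]
  · have e := h.2 x
    change -(R (-A x - (-z) • (x : X))) = x
    rw [← map_neg]
    convert e using 2
    rw [neg_smul]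
    abel

theorem mem_pmapSpectrum_neg {A : X →ₗ.[ℂ] X} {z : ℂ} :
    z ∈ pmapSpectrum (-A) ↔ -z ∈ pmapSpectrum A := by
  refine not_congr ⟨?_, ?_⟩
  · rintro ⟨R, hR⟩
    exact ⟨-R, by simpa using hR.neg⟩
  · rintro ⟨R, hR⟩
    exact ⟨-R, by simpa using hR.neg⟩

theorem IsEigenvector.mem_pmapSpectrum {A : X →ₗ.[ℂ] X} {z : ℂ} {x : X}
    (h : IsEigenvector A z x) : z ∈ pmapSpectrum A := by
  rintro ⟨R, hR⟩
  obtain ⟨h0, hx, e⟩ := h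
  have := hR.2 ⟨x, hx⟩
  rw [e, sub_self, map_zero] at this
  exact h0 this.symm

/-- A resolvent `R` of `M` is carried to the resolvent `W R W'` of `D`. Only `W W' = 1` is needed
for this inclusion; the opposite one comes from exchanging the roles. -/
theorem pmapSpectrum_subset_of_intertwining {M : X →ₗ.[ℂ] X} {D : Y →ₗ.[ℂ] Y} {W : X →L[ℂ] Y}
    {W' : Y →L[ℂ] X} (h1 : ∀ y, W (W' y) = y)
    (hW : ∀ x (hx : x ∈ M.domain), ∃ h : W x ∈ D.domain, D ⟨W x, h⟩ = W (M ⟨x, hx⟩))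
    (hW' : ∀ y (hy : y ∈ D.domain), ∃ h : W' y ∈ M.domain, M ⟨W' y, h⟩ = W' (D ⟨y, hy⟩)) :
    pmapSpectrum D ⊆ pmapSpectrum M := by
  rintro z hz ⟨R, hR⟩
  refine hz ⟨W ∘L R ∘L W', fun y => ?_, fun y => ?_⟩
  · obtain ⟨hx, e⟩ := hR.1 (W' y)
    obtain ⟨hd, e'⟩ := hW _ hx
    refine ⟨hd, ?_⟩
    change D ⟨W (R (W' y)), hd⟩ - z • W (R (W' y)) = y
    rw [e', ← map_smul, ← map_sub, e, h1]
  · obtain ⟨hd, e'⟩ := hW' y y.2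
    change W (R (W' (D y - z • (y : Y)))) = y
    rw [map_sub, map_smul, ← e', hR.2 ⟨_, hd⟩, h1]

/-- The diagonal corners of a resolvent of the block operator are resolvents of `P` and `Q`, without
knowing beforehand that it is block diagonal. Conversely the direct sum of two resolvents is a
resolvent. -/
theorem pmapSpectrum_blockPMap_diagonal (P : X →ₗ.[ℂ] X) (Q : Y →ₗ.[ℂ] Y) :
    pmapSpectrum (blockPMap P 0 0 Q) = pmapSpectrum P ∪ pmapSpectrum Q := by
  ext z
  rw [Set.mem_union, ← not_iff_not, not_or]
  simp only [pmapSpectrum, Set.mem_ofPred_eq, not_not]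
  have happ : ∀ p : (blockPMap P 0 0 Q).domain, blockPMap P 0 0 Q p
      = (P ⟨(p : X × Y).1, p.2.1⟩, Q ⟨(p : X × Y).2, p.2.2⟩) := fun p =>
    Prod.ext (add_zero _) (zero_add _)
  constructor
  · rintro ⟨R, hR⟩
    constructor
    · refine ⟨ContinuousLinearMap.fst ℂ X Y ∘L R ∘L ContinuousLinearMap.inl ℂ X Y,
        fun x => ?_, fun x => ?_⟩
      · obtain ⟨hx, e⟩ := hR.1 (x, 0)
        rw [happ] at e
        exact ⟨hx.1, congrArg Prod.fst e⟩
      · have e := hR.2 ⟨((x : X), 0), x.2, zero_mem _⟩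
        have e1 : blockPMap P 0 0 Q ⟨((x : X), 0), x.2, zero_mem _⟩ - z • ((x : X), (0 : Y))
            = (P x - z • (x : X), 0) := by
          rw [happ]
          exact Prod.ext rfl (by rw [Prod.snd_sub, Prod.smul_snd, smul_zero, sub_zero]; exact Q.map_zero)
        rw [e1] at e
        exact congrArg Prod.fst e
    · refine ⟨ContinuousLinearMap.snd ℂ X Y ∘L R ∘L ContinuousLinearMap.inr ℂ X Y,
        fun x => ?_, fun x => ?_⟩
      · obtain ⟨hx, e⟩ := hR.1 (0, x)
        rw [happ] at e
        exact ⟨hx.2, congrArg Prod.snd e⟩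
      · have e := hR.2 ⟨(0, (x : Y)), zero_mem _, x.2⟩
        have e1 : blockPMap P 0 0 Q ⟨(0, (x : Y)), zero_mem _, x.2⟩ - z • ((0 : X), (x : Y))
            = (0, Q x - z • (x : Y)) := by
          rw [happ]
          exact Prod.ext (by rw [Prod.fst_sub, Prod.smul_fst, smul_zero, sub_zero]; exact P.map_zero) rfl
        rw [e1] at e
        exact congrArg Prod.snd e
  · rintro ⟨⟨R, hR⟩, ⟨S, hS⟩⟩
    refine ⟨R.prodMap S, fun p => ?_, fun p => ?_⟩
    · obtain ⟨h1, e1⟩ := hR.1 p.1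
      obtain ⟨h2, e2⟩ := hS.1 p.2
      refine ⟨⟨h1, h2⟩, ?_⟩
      rw [happ]
      exact Prod.ext e1 e2
    · rw [happ]
      exact Prod.ext (hR.2 ⟨_, p.2.1⟩) (hS.2 ⟨_, p.2.2⟩)

end Spectrum

/-! ### Pairs of self-adjoint operators coupled by a Riccati equation -/

section Pair

variable {X Y : Type*} [NormedAddCommGroup X] [InnerProductSpace ℂ X]
  [NormedAddCommGroup Y] [InnerProductSpace ℂ Y]

/-- Self-adjoint operators `A`, `B`, mutually adjoint couplings `f`, `f'`, and mutually adjoint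
strict contractions `k`, `k'` such that the block form `[[A, -f], [-f', B]]` is bounded below by
`c > 0` and `A k + k B + f + k f' k = 0` holds weakly. -/
structure IsPairSystem (A : X →ₗ.[ℂ] X) (B : Y →ₗ.[ℂ] Y) (f k : Y →L[ℂ] X) (f' k' : X →L[ℂ] Y)
    (c : ℝ) : Prop where
  left : IsSelfAdjointPMap A
  right : IsSelfAdjointPMap B
  adjoint_f : ∀ x y, ⟪f y, x⟫_ℂ = ⟪y, f' x⟫_ℂ
  adjoint_k : ∀ x y, ⟪k y, x⟫_ℂ = ⟪y, k' x⟫_ℂ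
  norm_k : ‖k‖ < 1
  norm_k' : ‖k'‖ < 1
  c_pos : 0 < c
  coercive : ∀ (a : A.domain) (b : B.domain), c * (‖(a : X)‖ ^ 2 + ‖(b : Y)‖ ^ 2) ≤
    RCLike.re ⟪(a : X), A a⟫_ℂ + RCLike.re ⟪(b : Y), B b⟫_ℂ - 2 * RCLike.re ⟪(a : X), f b⟫_ℂ
  riccati : ∀ (a : A.domain) (b : B.domain),
    ⟪A a, k b⟫_ℂ + ⟪(a : X), k (B b)⟫_ℂ + ⟪(a : X), f b⟫_ℂ + ⟪(a : X), k (f' (k b))⟫_ℂ = 0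

/-- The operator `A + k ∘ f'` with the domain of `A`. -/
def dressedPMap (A : X →ₗ.[ℂ] X) (k : Y →L[ℂ] X) (f' : X →L[ℂ] Y) : X →ₗ.[ℂ] X :=
  ((k ∘L f' : X →L[ℂ] X) : X →ₗ[ℂ] X) +ᵥ A

theorem dressedPMap_apply (A : X →ₗ.[ℂ] X) (k : Y →L[ℂ] X) (f' : X →L[ℂ] Y) {x : X}
    (hx : x ∈ A.domain) : dressedPMap A k f' ⟨x, hx⟩ = k (f' x) + A ⟨x, hx⟩ := rfl

/-- Cauchy–Schwarz turns a bound on the numerical range into a lower bound on the operator. -/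
theorem le_norm_of_le_norm_inner {δ : ℝ} {x z : X} (h : δ * ‖x‖ ^ 2 ≤ ‖⟪x, z⟫_ℂ‖) :
    δ * ‖x‖ ≤ ‖z‖ := by
  rcases (norm_nonneg x).eq_or_lt with h0 | h0
  · rw [← h0, mul_zero]
    exact norm_nonneg z
  · have := h.trans (norm_inner_le_norm x z)
    nlinarith

namespace IsPairSystem

variable {A : X →ₗ.[ℂ] X} {B : Y →ₗ.[ℂ] Y} {f k : Y →L[ℂ] X} {f' k' : X →L[ℂ] Y} {c : ℝ}

theorem adjoint_f' (h : IsPairSystem A B f k f' k' c) (x : X) (y : Y) :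
    ⟪f' x, y⟫_ℂ = ⟪x, f y⟫_ℂ := by
  rw [← inner_conj_symm, ← h.adjoint_f, inner_conj_symm]

theorem adjoint_k' (h : IsPairSystem A B f k f' k' c) (x : X) (y : Y) :
    ⟪k' x, y⟫_ℂ = ⟪x, k y⟫_ℂ := by
  rw [← inner_conj_symm, ← h.adjoint_k, inner_conj_symm]

/-- The adjoint of the Riccati equation is the Riccati equation with the two sides exchanged, so
every result about `A` also holds for `B`. -/
theorem swap (h : IsPairSystem A B f k f' k' c) : IsPairSystem B A f' k' f k c where
  left := h.right
  right := h.left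
  adjoint_f y x := h.adjoint_f' x y
  adjoint_k y x := h.adjoint_k' x y
  norm_k := h.norm_k'
  norm_k' := h.norm_k
  c_pos := h.c_pos
  coercive b a := by
    have := h.coercive a b
    have e : RCLike.re ⟪(b : Y), f' a⟫_ℂ = RCLike.re ⟪(a : X), f b⟫_ℂ := by
      rw [← h.adjoint_f, inner_re_symm]
    rw [e]
    linarith
  riccati b a := by
    have e := congrArg conj (h.riccati a b)
    simp only [map_add, inner_conj_symm, map_zero] at e
    rw [h.adjoint_k, h.adjoint_k, h.adjoint_f, h.adjoint_k, h.adjoint_f', h.adjoint_k] at e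
    rw [add_comm ⟪B b, k' a⟫_ℂ]
    exact e

/-- `k` maps `dom B` into `dom A` and solves the Riccati equation there. -/
theorem strong_riccati (h : IsPairSystem A B f k f' k' c) {y : Y} (hy : y ∈ B.domain) :
    ∃ hk : k y ∈ A.domain, A ⟨k y, hk⟩ = -(k (B ⟨y, hy⟩) + f y + k (f' (k y))) := by
  refine h.left.maximal _ _ fun a => ?_
  have := h.riccati a ⟨y, hy⟩
  rw [inner_neg_right, inner_add_right, inner_add_right, eq_neg_iff_add_eq_zero, ← this]
  ring

theorem left_nonneg (h : IsPairSystem A B f k f' k' c) (a : A.domain) :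
    c * ‖(a : X)‖ ^ 2 ≤ RCLike.re ⟪(a : X), A a⟫_ℂ := by
  simpa using h.coercive a 0

theorem norm_k_comp_lt (h : IsPairSystem A B f k f' k' c) : ‖k ∘L k'‖ < 1 :=
  (k.opNorm_comp_le k').trans_lt (mul_lt_one_of_nonneg_of_lt_one_left (norm_nonneg _) h.norm_k
    h.norm_k'.le)

theorem isUnit [CompleteSpace X] (h : IsPairSystem A B f k f' k' c) : IsUnit (1 - k ∘L k') :=
  isUnit_one_sub_of_norm_lt_one h.norm_k_comp_lt

theorem sub_inverse [CompleteSpace X] (h : IsPairSystem A B f k f' k' c) (x : X) :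
    Ring.inverse (1 - k ∘L k') x - k (k' (Ring.inverse (1 - k ∘L k') x)) = x :=
  DFunLike.congr_fun (Ring.mul_inverse_cancel _ h.isUnit) x

theorem inverse_sub [CompleteSpace X] (h : IsPairSystem A B f k f' k' c) (x : X) :
    Ring.inverse (1 - k ∘L k') (x - k (k' x)) = x :=
  DFunLike.congr_fun (Ring.inverse_mul_cancel _ h.isUnit) x

/-- Obtained by inverting both factors in `k' (1 - k k') = (1 - k' k) k'`. -/
theorem k'_inverse [CompleteSpace X] [CompleteSpace Y] (h : IsPairSystem A B f k f' k' c)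
    (x : X) : k' (Ring.inverse (1 - k ∘L k') x) = Ring.inverse (1 - k' ∘L k) (k' x) := by
  rw [← h.swap.inverse_sub (k' (Ring.inverse (1 - k ∘L k') x)), ← map_sub, h.sub_inverse]

theorem sub_comp_mem (h : IsPairSystem A B f k f' k' c) {x : X} (hx : x ∈ A.domain) :
    x - k (k' x) ∈ A.domain :=
  sub_mem hx (h.strong_riccati (h.swap.strong_riccati hx).1).1

/-- The bounded commutator of `A` and `1 - k ∘ k'`. -/
theorem apply_sub (h : IsPairSystem A B f k f' k' c) {x : X} (hx : x ∈ A.domain) :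
    A ⟨x - k (k' x), h.sub_comp_mem hx⟩ = A ⟨x, hx⟩ - k (k' (A ⟨x, hx⟩))
      + (f (k' x) + k (f' (k (k' x))) - k (f' x) - k (k' (f (k' x)))) := by
  obtain ⟨h1, e1⟩ := h.swap.strong_riccati hx
  obtain ⟨h2, e2⟩ := h.strong_riccati h1
  have e3 : A ⟨x - k (k' x), h.sub_comp_mem hx⟩ = A ⟨x, hx⟩ - A ⟨k (k' x), h2⟩ :=
    A.map_sub ⟨x, hx⟩ ⟨_, h2⟩
  rw [e3, e2, e1]
  simp only [map_neg, map_add]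
  abel

/-- Coercivity gives `A ≥ c > 0`, hence `A + t` has trivial kernel for `t ≥ 0`. -/
theorem add_smul_injective (h : IsPairSystem A B f k f' k' c) {t : ℝ} (ht : 0 ≤ t)
    {x y : A.domain} (e : A x + (t : ℂ) • (x : X) = A y + (t : ℂ) • (y : X)) : x = y := by
  have e1 : A (x - y) = -((t : ℂ) • ((x - y : A.domain) : X)) := by
    rw [A.map_sub, Submodule.coe_sub, smul_sub, neg_sub, sub_eq_sub_iff_add_eq_add, e]
    abel
  have e2 := h.left_nonneg (x - y)
  rw [e1, inner_neg_right, inner_smul_right, inner_self_eq_norm_sq_to_K] at e2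
  have e3 : RCLike.re (-((t : ℂ) * ((‖((x - y : A.domain) : X)‖ : ℝ) : ℂ) ^ 2))
      = -(t * ‖((x - y : A.domain) : X)‖ ^ 2) := by
    rw [← Complex.ofReal_pow, ← Complex.ofReal_mul, ← Complex.ofReal_neg]
    exact Complex.ofReal_re _
  have e4 : c * ‖((x - y : A.domain) : X)‖ ^ 2 ≤ -(t * ‖((x - y : A.domain) : X)‖ ^ 2) :=
    e2.trans_eq e3
  have e5 : ‖((x - y : A.domain) : X)‖ ^ 2 ≤ 0 := by
    have := h.c_pos
    have := mul_nonneg ht (sq_nonneg ‖((x - y : A.domain) : X)‖)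
    by_contra hn
    nlinarith [mul_pos h.c_pos (not_le.1 hn)]
  have e6 : ((x - y : A.domain) : X) = 0 := by
    rw [← norm_eq_zero]
    exact pow_eq_zero_iff two_ne_zero |>.1 (le_antisymm e5 (sq_nonneg _))
  exact sub_eq_zero.1 (Subtype.ext e6)

/-- `(1 - k ∘ k')⁻¹` preserves the domain of `A`. -/
theorem mem_of_sub_mem [CompleteSpace X] (h : IsPairSystem A B f k f' k' c) {x : X}
    (hx : x - k (k' x) ∈ A.domain) : x ∈ A.domain := by
  set G := Ring.inverse (1 - k ∘L k') with hG
  let C : X →L[ℂ] X := f ∘L k' + k ∘L f' ∘L k ∘L k' - k ∘L f' - k ∘L k' ∘L f ∘L k'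
  have hC : ∀ x, C x = f (k' x) + k (f' (k (k' x))) - k (f' x) - k (k' (f (k' x))) := fun x => rfl
  -- Since `A ≥ 0`, this shift makes both `A + t + G C` and `A + t + (G C)*` bounded below by `t -
  -- ‖G C‖ = 1`, as `exists_inverse` requires; `hbound` covers both, because only the norm of the
  -- perturbation enters.
  set t : ℝ := ‖G ∘L C‖ + 1 with ht
  have ht0 : 0 ≤ t := by positivity
  let T : X →L[ℂ] X := -((t : ℂ) • ContinuousLinearMap.id ℂ X) - G ∘L C
  have hbound : ∀ S : X →L[ℂ] X, ‖S‖ = ‖G ∘L C‖ → ∀ a : A.domain,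
      1 * ‖(a : X)‖ ≤ ‖A a - (-((t : ℂ) • (a : X)) - S a)‖ := by
    intro S hS a
    apply le_norm_of_le_norm_inner
    refine le_trans ?_ (RCLike.re_le_norm _)
    have e1 := h.left_nonneg a
    have e2 : A a - (-((t : ℂ) • (a : X)) - S a) = A a + (t : ℂ) • (a : X) + S a := by abel
    have e3 : RCLike.re ⟪(a : X), (t : ℂ) • (a : X)⟫_ℂ = t * ‖(a : X)‖ ^ 2 := by
      rw [inner_smul_right, inner_self_eq_norm_sq_to_K]
      exact (Complex.re_ofReal_mul _ _).trans (by norm_cast)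
    have e4 : -(‖G ∘L C‖ * ‖(a : X)‖ ^ 2) ≤ RCLike.re ⟪(a : X), S a⟫_ℂ := by
      refine neg_le_of_abs_le ((RCLike.abs_re_le_norm _).trans
        ((norm_inner_le_norm _ _).trans ?_))
      have := S.le_opNorm (a : X)
      rw [hS] at this
      nlinarith [norm_nonneg (a : X)]
    rw [e2, inner_add_right, inner_add_right, map_add, map_add, e3, ht]
    nlinarith [mul_nonneg h.c_pos.le (sq_nonneg ‖(a : X)‖)]
  have hT : ∀ x, T x = -((t : ℂ) • x) - (G ∘L C) x := fun x => rfl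
  have hT' : ∀ x, ContinuousLinearMap.adjoint T x
      = -((t : ℂ) • x) - ContinuousLinearMap.adjoint (G ∘L C) x := by
    intro x
    refine ext_inner_left ℂ fun y => ?_
    rw [ContinuousLinearMap.adjoint_inner_right, hT, inner_sub_left, inner_sub_right,
      ContinuousLinearMap.adjoint_inner_right, inner_neg_left, inner_neg_right, inner_smul_left,
      inner_smul_right, Complex.conj_ofReal]
  obtain ⟨R, hR, -⟩ := h.left.exists_inverse T (ContinuousLinearMap.adjoint T)
    (fun x y => (ContinuousLinearMap.adjoint_inner_right T x y).symm) one_pos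
    (fun a => by rw [hT]; exact hbound _ rfl a)
    (fun a => by rw [hT']; exact hbound _ (LinearIsometryEquiv.norm_map _ _) a)
  set y := x - k (k' x) with hy
  -- On `dom A`, `G A (1 - k k') = A + G C`. So `a` solves the equation that `x` would satisfy if it
  -- were known to lie in `dom A`. Applying `1 - k k'` gives `(A + t)(1 - k k') a = (A + t) y`, and
  -- injectivity of `A + t` and of `1 - k k'` yields `a = x`.
  obtain ⟨ha, ea⟩ := hR (G (A ⟨y, hx⟩ + (t : ℂ) • y))
  set a := R (G (A ⟨y, hx⟩ + (t : ℂ) • y)) with ha'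
  have e1 : A ⟨a, ha⟩ + (t : ℂ) • a + G (C a) = G (A ⟨y, hx⟩ + (t : ℂ) • y) := by
    rw [← ea, hT]
    change _ = A ⟨a, ha⟩ - (-((t : ℂ) • a) - G (C a))
    abel
  have e2 := congrArg (fun w => w - k (k' w)) e1
  rw [h.sub_inverse] at e2
  have e3 : A ⟨a - k (k' a), h.sub_comp_mem ha⟩ + (t : ℂ) • (a - k (k' a))
      = A ⟨y, hx⟩ + (t : ℂ) • y := by
    rw [← e2, h.apply_sub ha, ← hC]
    have e4 : C a = G (C a) - k (k' (G (C a))) := (h.sub_inverse (C a)).symm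
    conv_lhs => rw [e4]
    simp only [map_add, map_smul, smul_sub]
    abel
  have e5 := congrArg Subtype.val (h.add_smul_injective ht0
    (x := ⟨a - k (k' a), h.sub_comp_mem ha⟩) (y := ⟨y, hx⟩) e3)
  have e6 : a = x := by
    rw [← h.inverse_sub a, ← h.inverse_sub x]
    exact congrArg _ e5
  exact e6 ▸ ha

theorem inverse_mem [CompleteSpace X] (h : IsPairSystem A B f k f' k' c) {x : X}
    (hx : x ∈ A.domain) : Ring.inverse (1 - k ∘L k') x ∈ A.domain :=
  h.mem_of_sub_mem (by rwa [h.sub_inverse])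

/-- This is the first row of `D W = W M`: inserting the Riccati value of `A (k y)`, the term `k (f'
(k y))` cancels against the dressing. -/
theorem dressedPMap_add (h : IsPairSystem A B f k f' k' c) {x : X} {y : Y} (hx : x ∈ A.domain)
    (hy : y ∈ B.domain) : ∃ hxy : x + k y ∈ A.domain, dressedPMap A k f' ⟨x + k y, hxy⟩
      = A ⟨x, hx⟩ - f y + k (f' x - B ⟨y, hy⟩) := by
  obtain ⟨hk, e⟩ := h.strong_riccati hy
  refine ⟨add_mem hx hk, ?_⟩
  have e1 : A ⟨x + k y, add_mem hx hk⟩ = A ⟨x, hx⟩ + A ⟨k y, hk⟩ := A.map_add ⟨x, hx⟩ ⟨_, hk⟩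
  rw [dressedPMap_apply, e1, e]
  simp only [map_add, map_sub]
  abel

end IsPairSystem

end Pair

section Pair

variable {X Y : Type*} [NormedAddCommGroup X] [InnerProductSpace ℂ X]
  [NormedAddCommGroup Y] [InnerProductSpace ℂ Y]

namespace IsPairSystem

variable {A : X →ₗ.[ℂ] X} {B : Y →ₗ.[ℂ] Y} {f k : Y →L[ℂ] X} {f' k' : X →L[ℂ] Y} {c : ℝ}

/-! #### The dressed operator `A + k ∘ f'` -/

section Dressed

variable [CompleteSpace X]

/-- Replace `x` by `(1 - k k') G x` with `G = (1 - k k')⁻¹` and move `k` to the other side. The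
right-hand side is the indefinite form `⟪·,·⟫_X - ⟪·,·⟫_Y` between `W⁻¹ (x, 0)` and `W⁻¹ (y, 0)`. -/
theorem inner_inverse_right (h : IsPairSystem A B f k f' k' c) (x y : X) :
    ⟪x, Ring.inverse (1 - k ∘L k') y⟫_ℂ
      = ⟪Ring.inverse (1 - k ∘L k') x, Ring.inverse (1 - k ∘L k') y⟫_ℂ
        - ⟪k' (Ring.inverse (1 - k ∘L k') x), k' (Ring.inverse (1 - k ∘L k') y)⟫_ℂ := by
  conv_lhs => rw [← h.sub_inverse x]
  rw [inner_sub_left, h.adjoint_k]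

theorem inner_inverse_left (h : IsPairSystem A B f k f' k' c) (x y : X) :
    ⟪Ring.inverse (1 - k ∘L k') x, y⟫_ℂ = ⟪x, Ring.inverse (1 - k ∘L k') y⟫_ℂ := by
  rw [h.inner_inverse_right, ← inner_conj_symm, h.inner_inverse_right, map_sub, inner_conj_symm,
    inner_conj_symm]

/-- With `g = (1 - k k')⁻¹ x`, `x = g - k k' g` has norm at most `2 ‖g‖`; this is the origin of the
factors `1 / 4` below. -/
theorem norm_sq_inverse (h : IsPairSystem A B f k f' k' c) (x : X) :
    ‖x‖ ^ 2 ≤ 4 * ‖Ring.inverse (1 - k ∘L k') x‖ ^ 2 := by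
  set g := Ring.inverse (1 - k ∘L k') x with hg
  have e1 : ‖k (k' g)‖ ≤ ‖g‖ := by
    have := (k ∘L k').le_of_opNorm_le h.norm_k_comp_lt.le g
    simpa using this
  have e2 : ‖x‖ ≤ 2 * ‖g‖ := by
    rw [← h.sub_inverse x, ← hg]
    linarith [norm_sub_le g (k (k' g))]
  nlinarith [norm_nonneg x, norm_nonneg g]

/-- `(1 - k ∘ k')⁻¹` is a positive operator, bounded below. -/
theorem inner_inverse_self (h : IsPairSystem A B f k f' k' c) (x : X) :
    ∃ q : ℝ, ⟪x, Ring.inverse (1 - k ∘L k') x⟫_ℂ = q ∧ (1 - ‖k'‖ ^ 2) / 4 * ‖x‖ ^ 2 ≤ q := by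
  set g := Ring.inverse (1 - k ∘L k') x with hg
  refine ⟨‖g‖ ^ 2 - ‖k' g‖ ^ 2, ?_, ?_⟩
  · rw [h.inner_inverse_right, inner_self_eq_norm_sq_to_K, inner_self_eq_norm_sq_to_K]
    push_cast
    rfl
  · have e1 := h.norm_sq_inverse x
    have e2 := k'.le_opNorm g
    have e3 : ‖k' g‖ ^ 2 ≤ ‖k'‖ ^ 2 * ‖g‖ ^ 2 := by
      rw [← mul_pow]
      gcongr
    have e4 : 0 ≤ 1 - ‖k'‖ ^ 2 := by nlinarith [h.norm_k', norm_nonneg k']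
    have := mul_le_mul_of_nonneg_left e1 e4
    linarith

/-- These are the two components of `M W⁻¹ (x, 0) = W⁻¹ (D (x, 0))`, the second one up to the choice
of signs. They follow from `dressedPMap_add` at `(g, -k' g)`, where `g + k (-k' g) = x`, and from
the Riccati equation for `k'`. -/
theorem inverse_dressedPMap (h : IsPairSystem A B f k f' k' c) {x : X} (hx : x ∈ A.domain)
    (hg : Ring.inverse (1 - k ∘L k') x ∈ A.domain)
    (hkg : k' (Ring.inverse (1 - k ∘L k') x) ∈ B.domain) :
    Ring.inverse (1 - k ∘L k') (dressedPMap A k f' ⟨x, hx⟩)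
        = A ⟨_, hg⟩ + f (k' (Ring.inverse (1 - k ∘L k') x)) ∧
      -k' (Ring.inverse (1 - k ∘L k') (dressedPMap A k f' ⟨x, hx⟩))
        = f' (Ring.inverse (1 - k ∘L k') x) + B ⟨_, hkg⟩ := by
  set g := Ring.inverse (1 - k ∘L k') x with hgx
  obtain ⟨h1, e1⟩ := h.dressedPMap_add hg (neg_mem hkg)
  obtain ⟨_, e2⟩ := h.swap.strong_riccati hg
  have e3 : B ⟨-k' g, neg_mem hkg⟩ = -B ⟨k' g, hkg⟩ := B.map_neg ⟨_, hkg⟩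
  have e4 : dressedPMap A k f' ⟨g + k (-k' g), h1⟩ = dressedPMap A k f' ⟨x, hx⟩ := by
    congr 2
    rw [map_neg, ← sub_eq_add_neg, h.sub_inverse]
  have e5 : f' g + B ⟨_, hkg⟩ = -k' (A ⟨_, hg⟩ + f (k' g)) := by
    rw [e2, map_add]
    abel
  have e6 : Ring.inverse (1 - k ∘L k') (dressedPMap A k f' ⟨x, hx⟩) = A ⟨_, hg⟩ + f (k' g) := by
    rw [← e4, e1, e3, sub_neg_eq_add, e5, map_neg f, sub_neg_eq_add, map_neg k,
      ← sub_eq_add_neg, h.inverse_sub]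
  rw [e6, e5]
  exact ⟨rfl, rfl⟩

/-- The right-hand side is the sesquilinear form of `[[A, -f], [-f', B]]` between `(G y, -k' G y)`
and `(G x, -k' G x)`, where `G = (1 - k k')⁻¹`. Symmetry and positivity of `G (A + k f')` are read
off from it. -/
theorem inner_inverse_dressedPMap (h : IsPairSystem A B f k f' k' c) {x y : X}
    (hx : x ∈ A.domain) (hg : Ring.inverse (1 - k ∘L k') x ∈ A.domain)
    (hkg : k' (Ring.inverse (1 - k ∘L k') x) ∈ B.domain) :
    ⟪y, Ring.inverse (1 - k ∘L k') (dressedPMap A k f' ⟨x, hx⟩)⟫_ℂ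
      = ⟪Ring.inverse (1 - k ∘L k') y, A ⟨_, hg⟩⟫_ℂ
        + ⟪Ring.inverse (1 - k ∘L k') y, f (k' (Ring.inverse (1 - k ∘L k') x))⟫_ℂ
        + ⟪k' (Ring.inverse (1 - k ∘L k') y), f' (Ring.inverse (1 - k ∘L k') x)⟫_ℂ
        + ⟪k' (Ring.inverse (1 - k ∘L k') y), B ⟨_, hkg⟩⟫_ℂ := by
  obtain ⟨e1, e2⟩ := h.inverse_dressedPMap hx hg hkg
  rw [h.inner_inverse_right, sub_eq_add_neg, ← inner_neg_right, e2, e1, inner_add_right,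
    inner_add_right]
  ring

/-- `(1 - k ∘ k')⁻¹ ∘ (A + k ∘ f')` is bounded below by `c / 4`. -/
theorem le_inner_inverse_dressedPMap (h : IsPairSystem A B f k f' k' c) {x : X}
    (hx : x ∈ A.domain) : c / 4 * ‖x‖ ^ 2
      ≤ RCLike.re ⟪x, Ring.inverse (1 - k ∘L k') (dressedPMap A k f' ⟨x, hx⟩)⟫_ℂ := by
  have hg := h.inverse_mem hx
  have hkg := (h.swap.strong_riccati hg).1
  rw [h.inner_inverse_dressedPMap hx hg hkg]
  set g := Ring.inverse (1 - k ∘L k') x with hgx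
  have e1 := h.coercive ⟨g, hg⟩ ⟨-k' g, neg_mem hkg⟩
  have e2 : B ⟨-k' g, neg_mem hkg⟩ = -B ⟨k' g, hkg⟩ := B.map_neg ⟨_, hkg⟩
  have e3 : RCLike.re ⟪k' g, f' g⟫_ℂ = RCLike.re ⟪g, f (k' g)⟫_ℂ := by
    rw [← h.adjoint_f, inner_re_symm]
  have e4 := h.norm_sq_inverse x
  rw [e2] at e1
  simp only [norm_neg, map_neg, inner_neg_left, inner_neg_right, neg_neg] at e1
  simp only [map_add]
  rw [e3]
  have e5 := mul_nonneg h.c_pos.le (sq_nonneg ‖k' g‖)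
  have e6 := mul_le_mul_of_nonneg_left e4 h.c_pos.le
  linarith

/-- Although `A + k f'` need not be symmetric, multiplying by `(1 - k k')⁻¹` makes it self-adjoint.
This replaces a similarity by the square root of that operator. -/
theorem isSelfAdjointPMap_inverse_dressedPMap (h : IsPairSystem A B f k f' k' c) :
    IsSelfAdjointPMap
      (((Ring.inverse (1 - k ∘L k') : X →L[ℂ] X) : X →ₗ[ℂ] X).compPMap (dressedPMap A k f')) := by
  set G := Ring.inverse (1 - k ∘L k') with hG
  have hsymm : ∀ x y : (dressedPMap A k f').domain, ⟪G (dressedPMap A k f' x), (y : X)⟫_ℂ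
      = ⟪(x : X), G (dressedPMap A k f' y)⟫_ℂ := by
    intro x y
    have hx := h.inverse_mem x.2
    have hy := h.inverse_mem y.2
    have hkx := (h.swap.strong_riccati hx).1
    have hky := (h.swap.strong_riccati hy).1
    rw [← inner_conj_symm, h.inner_inverse_dressedPMap x.2 hx hkx,
      h.inner_inverse_dressedPMap y.2 hy hky]
    simp only [map_add, inner_conj_symm]
    rw [h.left.symm ⟨_, hx⟩ ⟨_, hy⟩, h.right.symm ⟨_, hkx⟩ ⟨_, hky⟩, h.adjoint_f, h.adjoint_f']
    ring
  refine ⟨hsymm, fun y z hyz => ?_⟩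
  -- Moving `G` and the bounded term `k f'` (adjoint `f k'`) to the right leaves a test against `A`
  -- alone, so `G y ∈ dom A`; then `y = (1 - k k') G y` is in `dom A` as well.
  obtain ⟨h1, -⟩ := h.left.maximal (G y) (z - f (k' (G y))) (fun x => by
    have e1 : ⟪G (dressedPMap A k f' ⟨x, x.2⟩), y⟫_ℂ = ⟪(x : X), z⟫_ℂ := hyz x
    rw [h.inner_inverse_left, dressedPMap_apply A k f' x.2, inner_add_left, h.adjoint_k,
      h.adjoint_f'] at e1
    rw [inner_sub_right]
    exact eq_sub_of_add_eq' e1)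
  have hy : y ∈ A.domain := by
    rw [← h.sub_inverse y]
    exact h.sub_comp_mem h1
  refine ⟨hy, sub_eq_zero.1 (h.left.eq_zero_of_orthogonal fun x => ?_)⟩
  rw [inner_sub_right, sub_eq_zero, ← hyz x]
  exact (hsymm x ⟨y, hy⟩).symm

/-- The form `⟪x, G (A + k f') x⟫ - z ⟪x, G x⟫`, with `G = (1 - k k')⁻¹`, has real first term at
least `c / 4 ‖x‖²` and positive `⟪x, G x⟫`. For real `z ≤ 0` its real part is large enough; for
nonreal `z` its imaginary part is. -/
theorem exists_lower_bound (h : IsPairSystem A B f k f' k' c) {z : ℂ}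
    (hz : ¬(z.im = 0 ∧ 0 < z.re)) : ∃ δ : ℝ, 0 < δ ∧ ∀ x : (dressedPMap A k f').domain, δ * ‖(x : X)‖ ≤
      ‖Ring.inverse (1 - k ∘L k') (dressedPMap A k f' x)
        - z • Ring.inverse (1 - k ∘L k') (x : X)‖ := by
  set G := Ring.inverse (1 - k ∘L k') with hG
  have hk : 0 < (1 - ‖k'‖ ^ 2) / 4 := by nlinarith [h.norm_k', norm_nonneg k']
  have him : ∀ x : (dressedPMap A k f').domain, (⟪(x : X), G (dressedPMap A k f' x)⟫_ℂ).im = 0 := fun x =>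
    Complex.conj_eq_iff_im.1 ((inner_conj_symm _ _).trans
      (h.isSelfAdjointPMap_inverse_dressedPMap.symm x x))
  by_cases hzi : z.im = 0
  · have hzr : z.re ≤ 0 := not_lt.1 fun hlt => hz ⟨hzi, hlt⟩
    refine ⟨c / 4, by linarith [h.c_pos], fun x => le_norm_of_le_norm_inner ?_⟩
    obtain ⟨q, e1, e2⟩ := h.inner_inverse_self (x : X)
    have e3 : c / 4 * ‖(x : X)‖ ^ 2 ≤ (⟪(x : X), G (dressedPMap A k f' x)⟫_ℂ).re :=
      h.le_inner_inverse_dressedPMap x.2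
    refine le_trans ?_ (Complex.re_le_norm _)
    rw [inner_sub_right, inner_smul_right, e1, Complex.sub_re, Complex.mul_re, hzi]
    simp only [Complex.ofReal_re, zero_mul, sub_zero]
    nlinarith [mul_nonneg hk.le (sq_nonneg ‖(x : X)‖)]
  · refine ⟨|z.im| * ((1 - ‖k'‖ ^ 2) / 4), mul_pos (abs_pos.2 hzi) hk,
      fun x => le_norm_of_le_norm_inner ?_⟩
    obtain ⟨q, e1, e2⟩ := h.inner_inverse_self (x : X)
    refine le_trans ?_ (Complex.abs_im_le_norm _)
    rw [inner_sub_right, inner_smul_right, e1, Complex.sub_im, him, Complex.mul_im]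
    simp only [Complex.ofReal_re, Complex.ofReal_im, mul_zero, zero_add, zero_sub, abs_neg]
    rw [abs_mul, mul_assoc]
    exact mul_le_mul_of_nonneg_left (e2.trans (le_abs_self q)) (abs_nonneg _)

/-- The spectrum of `A + k ∘ f'` lies in `(0, ∞)`. -/
theorem spectrum_dressedPMap (h : IsPairSystem A B f k f' k' c) {z : ℂ}
    (hz : z ∈ pmapSpectrum (dressedPMap A k f')) : z.im = 0 ∧ 0 < z.re := by
  by_contra hn
  refine hz ?_
  set G := Ring.inverse (1 - k ∘L k') with hG
  obtain ⟨δ, hδ, h1⟩ := h.exists_lower_bound hn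
  obtain ⟨δ', hδ', h2⟩ := h.exists_lower_bound (z := conj z) (by simpa using hn)
  -- Invert the pencil `G (A + k f') - z G` rather than `A + k f' - z`: the former is a self-adjoint
  -- operator minus a bounded one with adjoint `conj z • G`. Composing with `G` on the right gives
  -- the resolvent of `A + k f'`.
  obtain ⟨R, hR, hR'⟩ := h.isSelfAdjointPMap_inverse_dressedPMap.exists_inverse (z • G)
    (conj z • G) (fun x y => by
      change ⟪z • G x, y⟫_ℂ = ⟪x, conj z • G y⟫_ℂ
      rw [inner_smul_left, inner_smul_right, h.inner_inverse_left]) (lt_min hδ hδ')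
    (fun x => (mul_le_mul_of_nonneg_right (min_le_left _ _) (norm_nonneg _)).trans (h1 x))
    (fun x => (mul_le_mul_of_nonneg_right (min_le_right _ _) (norm_nonneg _)).trans (h2 x))
  refine ⟨R ∘L G, fun x => ?_, fun x => ?_⟩
  · obtain ⟨hx, e⟩ := hR (G x)
    refine ⟨hx, ?_⟩
    have e1 : G (dressedPMap A k f' ⟨R (G x), hx⟩ - z • R (G x)) = G x := by
      rw [map_sub, map_smul]
      exact e
    have e2 := h.sub_inverse (dressedPMap A k f' ⟨R (G x), hx⟩ - z • R (G x))
    rw [← hG, e1, h.sub_inverse] at e2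
    exact e2.symm
  · have := hR' x
    change R (G (dressedPMap A k f' x - z • (x : X))) = x
    rw [map_sub, map_smul]
    exact this

end Dressed

/-! #### Block diagonalization -/

/-- Eliminating one component by `(p.1 + k p.2) - k (k' p.1 + p.2) = (1 - k k') p.1` reduces the
nontrivial direction to `mem_of_sub_mem`. -/
theorem mem_domain_iff [CompleteSpace X] [CompleteSpace Y] (h : IsPairSystem A B f k f' k' c)
    (p : X × Y) : (p.1 + k p.2 ∈ A.domain ∧ k' p.1 + p.2 ∈ B.domain)
      ↔ (p.1 ∈ A.domain ∧ p.2 ∈ B.domain) := by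
  constructor
  · rintro ⟨h1, h2⟩
    constructor
    · refine h.mem_of_sub_mem ?_
      have := sub_mem h1 (h.strong_riccati h2).1
      rwa [map_add, add_sub_add_right_eq_sub] at this
    · refine h.swap.mem_of_sub_mem ?_
      have := sub_mem h2 (h.swap.strong_riccati h1).1
      rwa [map_add, add_sub_add_left_eq_sub] at this
  · rintro ⟨h1, h2⟩
    exact ⟨add_mem h1 (h.strong_riccati h2).1, add_mem (h.swap.strong_riccati h1).1 h2⟩

/-- The block operator `[[1, k], [k', 1]]` intertwines `[[A, -f], [f', -B]]` and
`diag (A + k ∘ f', -B - k' ∘ f)`. -/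
theorem intertwining (h : IsPairSystem A B f k f' k' c) (p : X × Y)
    (hp : p ∈ (blockPMap A (-f) f' (-B)).domain)
    (hWp : blockCLM 1 k k' 1 p
      ∈ (blockPMap (dressedPMap A k f') 0 0 (-dressedPMap B k' f)).domain) :
    blockPMap (dressedPMap A k f') 0 0 (-dressedPMap B k' f) ⟨blockCLM 1 k k' 1 p, hWp⟩
      = blockCLM 1 k k' 1 (blockPMap A (-f) f' (-B) ⟨p, hp⟩) := by
  obtain ⟨h1, e1⟩ := h.dressedPMap_add hp.1 hp.2
  obtain ⟨h2, e2⟩ := h.swap.dressedPMap_add hp.2 hp.1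
  have e3 : dressedPMap B k' f ⟨k' p.1 + p.2, add_comm p.2 (k' p.1) ▸ h2⟩
      = dressedPMap B k' f ⟨p.2 + k' p.1, h2⟩ := by
    congr 2
    exact add_comm _ _
  refine Prod.ext ?_ ?_
  · change dressedPMap A k f' ⟨p.1 + k p.2, h1⟩ + 0
      = A ⟨p.1, hp.1⟩ + -(f p.2) + k (f' p.1 + -B ⟨p.2, hp.2⟩)
    rw [add_zero, e1, sub_eq_add_neg, sub_eq_add_neg]
  · change 0 + -dressedPMap B k' f ⟨k' p.1 + p.2, _⟩
      = k' (A ⟨p.1, hp.1⟩ + -(f p.2)) + (f' p.1 + -B ⟨p.2, hp.2⟩)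
    rw [e3, e2]
    simp only [map_add, map_neg, map_sub]
    abel

variable [CompleteSpace X] [CompleteSpace Y]

theorem blockCLM_comp_inverse (h : IsPairSystem A B f k f' k' c) :
    blockCLM 1 k k' 1 ∘L blockCLM (Ring.inverse (1 - k ∘L k'))
      (-(k ∘L Ring.inverse (1 - k' ∘L k))) (-(k' ∘L Ring.inverse (1 - k ∘L k')))
      (Ring.inverse (1 - k' ∘L k)) = 1 := by
  refine ContinuousLinearMap.ext fun p => Prod.ext ?_ ?_
  · change (Ring.inverse (1 - k ∘L k') p.1 + -(k (Ring.inverse (1 - k' ∘L k) p.2)))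
      + k (-(k' (Ring.inverse (1 - k ∘L k') p.1)) + Ring.inverse (1 - k' ∘L k) p.2) = p.1
    conv_rhs => rw [← h.sub_inverse p.1]
    rw [map_add, map_neg]
    abel
  · change k' (Ring.inverse (1 - k ∘L k') p.1 + -(k (Ring.inverse (1 - k' ∘L k) p.2)))
      + (-(k' (Ring.inverse (1 - k ∘L k') p.1)) + Ring.inverse (1 - k' ∘L k) p.2) = p.2
    conv_rhs => rw [← h.swap.sub_inverse p.2]
    rw [map_add, map_neg]
    abel

/-- On this side the inverses stand to the left of `k` and `k'`, so `k'_inverse` is needed to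
combine the terms. -/
theorem inverse_comp_blockCLM (h : IsPairSystem A B f k f' k' c) :
    blockCLM (Ring.inverse (1 - k ∘L k'))
      (-(k ∘L Ring.inverse (1 - k' ∘L k))) (-(k' ∘L Ring.inverse (1 - k ∘L k')))
      (Ring.inverse (1 - k' ∘L k)) ∘L blockCLM 1 k k' 1 = 1 := by
  refine ContinuousLinearMap.ext fun p => Prod.ext ?_ ?_
  · change Ring.inverse (1 - k ∘L k') (p.1 + k p.2)
      + -(k (Ring.inverse (1 - k' ∘L k) (k' p.1 + p.2))) = p.1
    rw [h.swap.k'_inverse, ← sub_eq_add_neg, ← map_sub, map_add, add_sub_add_right_eq_sub,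
      h.inverse_sub]
  · change -(k' (Ring.inverse (1 - k ∘L k') (p.1 + k p.2)))
      + Ring.inverse (1 - k' ∘L k) (k' p.1 + p.2) = p.2
    rw [h.k'_inverse, neg_add_eq_sub, ← map_sub, map_add, add_sub_add_left_eq_sub,
      h.swap.inverse_sub]

end IsPairSystem

end Pair

/-! ### Conjugation and integral operators on `L²(ℝ³)` -/

theorem inner_L2_eq (a b : L2) : ⟪a, b⟫_ℂ = ∫ x, conj (a x) * b x := by
  rw [L2.inner_def]
  refine integral_congr_ae (Filter.Eventually.of_forall fun x => ?_)
  simp [mul_comm]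

theorem pairing_eq_inner (a b : L2) : pairing a b = ⟪star a, b⟫_ℂ := by
  rw [inner_L2_eq, pairing]
  apply integral_congr_ae
  filter_upwards [Lp.coeFn_star a] with x h
  simp [h]

theorem star_zero_L2 : star (0 : L2) = 0 := conjL2.map_zero

theorem star_sub_L2 (a b : L2) : star (a - b) = star a - star b := conjL2.map_sub a b

theorem conjOp_apply (A : L2 →L[ℂ] L2) (u : L2) : conjOp A u = star (A (star u)) := rfl

theorem adjoint_eq_conjOp {k : L2 →L[ℂ] L2} (hk : transposeOp k = k) :
    ContinuousLinearMap.adjoint k = conjOp k := by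
  refine ContinuousLinearMap.ext fun u => ?_
  conv_rhs => rw [← hk]
  rw [conjOp_apply, transposeOp, conjOp_apply, star_star, star_star]

theorem norm_conjOp_le (A : L2 →L[ℂ] L2) : ‖conjOp A‖ ≤ ‖A‖ :=
  ContinuousLinearMap.opNorm_le_bound _ (norm_nonneg _) fun u => by
    rw [conjOp_apply, norm_star_L2, ← norm_star_L2 u]
    exact A.le_opNorm _

theorem coeFn_kernelOp {K : R3 × R3 → ℂ} (hK : MemLp K 2 ((volume : Measure R3).prod volume))
    (u : L2) : kernelOp K u =ᵐ[volume] fun x => ∫ y, K (x, y) * u y := by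
  unfold kernelOp
  rw [dif_pos hK]
  exact (kernel_section_bound hK u).1.coeFn_toLp

theorem memLp_prod_mul {a b : R3 → ℂ} (ha : MemLp a 2 (volume : Measure R3))
    (hb : MemLp b 2 (volume : Measure R3)) :
    MemLp (fun z : R3 × R3 => a z.1 * b z.2) 2 ((volume : Measure R3).prod volume) := by
  have hm : AEStronglyMeasurable (fun z : R3 × R3 => a z.1 * b z.2)
      ((volume : Measure R3).prod volume) := ha.1.comp_fst.mul hb.1.comp_snd
  rw [memLp_two_iff_integrable_sq_norm hm]
  refine (((memLp_two_iff_integrable_sq_norm ha.1).1 ha).mul_prod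
    ((memLp_two_iff_integrable_sq_norm hb.1).1 hb)).congr ?_
  refine Filter.Eventually.of_forall fun z => ?_
  simp [mul_pow]

theorem integrable_kernel {K : R3 × R3 → ℂ} (hK : MemLp K 2 ((volume : Measure R3).prod volume))
    (w u : L2) : Integrable (fun z : R3 × R3 => conj (w z.1) * (K z * u z.2))
      ((volume : Measure R3).prod volume) := by
  have h1 : MemLp (fun x => conj (w x)) 2 (volume : Measure R3) := (Lp.memLp w).star
  refine (hK.integrable_mul (memLp_prod_mul h1 (Lp.memLp u))).congr ?_
  refine Filter.Eventually.of_forall fun z => ?_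
  simp only [Pi.mul_apply]
  ring

theorem inner_kernelOp {K : R3 × R3 → ℂ} (hK : MemLp K 2 ((volume : Measure R3).prod volume))
    (w u : L2) : ⟪w, kernelOp K u⟫_ℂ
      = ∫ z : R3 × R3, conj (w z.1) * (K z * u z.2) ∂((volume : Measure R3).prod volume) := by
  rw [integral_prod _ (integrable_kernel hK w u), inner_L2_eq]
  apply integral_congr_ae
  filter_upwards [coeFn_kernelOp hK u] with x hx
  rw [hx, ← integral_const_mul]

/-- The adjoint of an integral operator has the conjugate kernel with interchanged variables. -/
theorem inner_kernelOp_left {K K' : R3 × R3 → ℂ}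
    (hK : MemLp K 2 ((volume : Measure R3).prod volume))
    (hK' : MemLp K' 2 ((volume : Measure R3).prod volume)) (h : ∀ z, K' z = conj (K z.swap))
    (u w : L2) : ⟪kernelOp K u, w⟫_ℂ = ⟪u, kernelOp K' w⟫_ℂ := by
  rw [← inner_conj_symm, inner_kernelOp hK, inner_kernelOp hK', ← integral_conj,
    ← integral_prod_swap]
  refine integral_congr_ae (Filter.Eventually.of_forall fun z => ?_)
  simp only [h, map_mul, Complex.conj_conj, Prod.fst_swap, Prod.snd_swap]
  ring

theorem star_kernelOp {K K' : R3 × R3 → ℂ} (hK : MemLp K 2 ((volume : Measure R3).prod volume))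
    (hK' : MemLp K' 2 ((volume : Measure R3).prod volume)) (h : ∀ z, K' z = conj (K z)) (u : L2) :
    star (kernelOp K u) = kernelOp K' (star u) := by
  apply Lp.ext
  filter_upwards [Lp.coeFn_star (kernelOp K u), coeFn_kernelOp hK u,
    coeFn_kernelOp hK' (star u)] with x h1 h2 h3
  rw [h1, h3, Pi.star_apply, h2]
  change conj _ = _
  rw [← integral_conj]
  apply integral_congr_ae
  filter_upwards [Lp.coeFn_star u] with y hy
  simp [hy, h]

/-- Dominated by `C |a(x)| |b(y)|`. Boundedness of `v` thus makes all kernels Hilbert–Schmidt, so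
that `kernelOp` never takes its default value `0`. -/
theorem memLp_pair_kernel {v : R3 → ℝ} (hv : ∀ x, 0 ≤ v x)
    (hvm : AEStronglyMeasurable v (volume : Measure R3)) {C : ℝ} (hC : ∀ x, v x ≤ C)
    {a b : R3 → ℂ} (ha : MemLp a 2 (volume : Measure R3)) (hb : MemLp b 2 (volume : Measure R3)) :
    MemLp (fun z : R3 × R3 => a z.1 * (v (z.1 - z.2) : ℂ) * b z.2) 2
      ((volume : Measure R3).prod volume) := by
  have hm : AEStronglyMeasurable (fun z : R3 × R3 => (v (z.1 - z.2) : ℂ))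
      ((volume : Measure R3).prod volume) :=
    Complex.continuous_ofReal.comp_aestronglyMeasurable
      (hvm.comp_quasiMeasurePreserving (quasiMeasurePreserving_sub volume volume))
  refine (memLp_prod_mul ha hb).of_le_mul (c := C)
    ((ha.1.comp_fst.mul hm).mul hb.1.comp_snd) (Filter.Eventually.of_forall fun z => ?_)
  rw [norm_mul, norm_mul, norm_mul, Complex.norm_real, Real.norm_of_nonneg (hv _)]
  have := mul_le_mul_of_nonneg_right (hC (z.1 - z.2))
    (mul_nonneg (norm_nonneg (a z.1)) (norm_nonneg (b z.2)))
  linarith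

/-! ### The kernels `γ` and `f_φ` -/

section Kernels

variable {v : R3 → ℝ} (N : ℕ) (φ : L2)

theorem memLp_gammaKernel (hv : ∀ x, 0 ≤ v x)
    (hvm : AEStronglyMeasurable v (volume : Measure R3)) {C : ℝ} (hC : ∀ x, v x ≤ C) :
    MemLp (gammaKernel v φ) 2 ((volume : Measure R3).prod volume) := by
  have h : MemLp (fun x => conj (φ x)) 2 (volume : Measure R3) := (Lp.memLp φ).star
  have e : gammaKernel v φ = fun z => φ z.1 * (v (z.1 - z.2) : ℂ) * (fun x => conj (φ x)) z.2 := by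
    funext z
    rw [gammaKernel]
  rw [e]
  exact memLp_pair_kernel hv hvm hC (Lp.memLp φ) h

theorem memLp_fKernel (hv : ∀ x, 0 ≤ v x)
    (hvm : AEStronglyMeasurable v (volume : Measure R3)) {C : ℝ} (hC : ∀ x, v x ≤ C) :
    MemLp (fKernel v N φ) 2 ((volume : Measure R3).prod volume) := by
  have h : MemLp (fun x => (N : ℂ) * φ x) 2 (volume : Measure R3) :=
    (Lp.memLp φ).const_mul (N : ℂ)
  have key := memLp_pair_kernel hv hvm hC h (Lp.memLp φ)
  have e : fKernel v N φ = fun z => N * φ z.1 * (v (z.1 - z.2) : ℂ) * φ z.2 := by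
    funext z
    rw [fKernel]
  rw [e]
  exact key

theorem v_sub_comm (hvsymm : ∀ x, v (-x) = v x) (x y : R3) : v (y - x) = v (x - y) := by
  rw [← hvsymm, neg_sub]

/-- Since `v` is real and even, `γ` is Hermitian: transposing it is conjugating it. This is why `hᵀ`
is the complex conjugate of `h`. -/
theorem gammaKernel_swap (hvsymm : ∀ x, v (-x) = v x) (z : R3 × R3) :
    gammaKernel v φ z.swap = conj (gammaKernel v φ z) := by
  simp only [gammaKernel, Prod.fst_swap, Prod.snd_swap, v_sub_comm hvsymm z.1 z.2, map_mul,
    Complex.conj_conj, Complex.conj_ofReal]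
  ring

theorem fKernel_swap (hvsymm : ∀ x, v (-x) = v x) (z : R3 × R3) :
    fKernel v N φ z.swap = fKernel v N φ z := by
  simp only [fKernel, Prod.fst_swap, Prod.snd_swap, v_sub_comm hvsymm z.1 z.2]
  ring

end Kernels

/-! ### Schrödinger operators -/

theorem L2_eq_zero_of_integral_smul {g : L2}
    (h : ∀ ψ : R3 → ℝ, ContDiff ℝ (⊤ : ℕ∞) ψ → HasCompactSupport ψ → ∫ x, ψ x • g x = 0) :
    g = 0 := by
  have h1 : LocallyIntegrable g (volume : Measure R3) :=
    (Lp.memLp g).locallyIntegrable (by norm_num)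
  apply Lp.ext
  filter_upwards [ae_eq_zero_of_integral_contDiff_smul_eq_zero h1 h,
    Lp.coeFn_zero ℂ 2 (volume : Measure R3)] with x h2 h3
  rw [h2, h3, Pi.zero_apply]

theorem memLp_test {ψ : R3 → ℝ} (hψ : Continuous ψ) (hc : HasCompactSupport ψ) :
    MemLp (fun x => (ψ x : ℂ)) 2 (volume : Measure R3) :=
  (hψ.memLp_of_hasCompactSupport hc (p := 2) (μ := (volume : Measure R3))).ofReal

/-- A continuous real function with compact support, as an element of `L²`. -/
def testL2 {ψ : R3 → ℝ} (hψ : Continuous ψ) (hc : HasCompactSupport ψ) : L2 :=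
  (memLp_test hψ hc).toLp _

theorem inner_testL2 {ψ : R3 → ℝ} (hψ : Continuous ψ) (hc : HasCompactSupport ψ) (u : L2) :
    ⟪testL2 hψ hc, u⟫_ℂ = ∫ x, ψ x • u x := by
  rw [inner_L2_eq]
  apply integral_congr_ae
  filter_upwards [(memLp_test hψ hc).coeFn_toLp] with x h
  rw [testL2, h, Complex.conj_ofReal, Complex.real_smul]

theorem continuous_partial {ψ : R3 → ℝ} (hψ : ContDiff ℝ (⊤ : ℕ∞) ψ) (i : Fin 3) :
    Continuous fun x => fderiv ℝ ψ x (EuclideanSpace.single i 1) :=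
  (hψ.continuous_fderiv (by simp)).clm_apply continuous_const

theorem hasCompactSupport_partial {ψ : R3 → ℝ} (hc : HasCompactSupport ψ) (i : Fin 3) :
    HasCompactSupport fun x => fderiv ℝ ψ x (EuclideanSpace.single i 1) :=
  hc.fderiv_apply ℝ _

theorem isWeakGradient_testL2 {ψ : R3 → ℝ} (hψ : ContDiff ℝ (⊤ : ℕ∞) ψ)
    (hc : HasCompactSupport ψ) : IsWeakGradient (testL2 hψ.continuous hc)
      (fun i => testL2 (continuous_partial hψ i) (hasCompactSupport_partial hc i)) := by
  intro i χ hχ hχc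
  have e1 : ∫ x, (fderiv ℝ χ x (EuclideanSpace.single i 1)) • testL2 hψ.continuous hc x
      = ∫ x, ((fderiv ℝ χ x (EuclideanSpace.single i 1) * ψ x : ℝ) : ℂ) := by
    apply integral_congr_ae
    filter_upwards [(memLp_test hψ.continuous hc).coeFn_toLp] with x h
    rw [testL2, h, Complex.real_smul, Complex.ofReal_mul]
  have e2 : ∫ x, χ x • testL2 (continuous_partial hψ i) (hasCompactSupport_partial hc i) x
      = ∫ x, ((χ x * fderiv ℝ ψ x (EuclideanSpace.single i 1) : ℝ) : ℂ) := by
    apply integral_congr_ae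
    filter_upwards [(memLp_test (continuous_partial hψ i)
      (hasCompactSupport_partial hc i)).coeFn_toLp] with x h
    rw [testL2, h, Complex.real_smul, Complex.ofReal_mul]
  have e3 := integral_mul_fderiv_eq_neg_fderiv_mul_of_integrable (μ := (volume : Measure R3))
    (f := χ) (g := ψ) (v := EuclideanSpace.single i 1)
    (((continuous_partial hχ i).mul hψ.continuous).integrable_of_hasCompactSupport hc.mul_left)
    ((hχ.continuous.mul (continuous_partial hψ i)).integrable_of_hasCompactSupport hχc.mul_right)
    ((hχ.continuous.mul hψ.continuous).integrable_of_hasCompactSupport hc.mul_left)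
    (fun x _ => (hχ.differentiable (by simp)).differentiableAt)
    (fun x _ => (hψ.differentiable (by simp)).differentiableAt)
  rw [e1, e2, integral_complex_ofReal, integral_complex_ofReal, e3, Complex.ofReal_neg, neg_neg]

/-- Local integrability of `U` is what makes `∫ U ψ²` finite, so that test functions belong to the
form domain. -/
theorem memWeighted_testL2 {U : R3 → ℝ} (hU : ∀ x, 0 ≤ U x)
    (hloc : LocallyIntegrable U (volume : Measure R3)) {ψ : R3 → ℝ} (hψ : Continuous ψ)
    (hc : HasCompactSupport ψ) : MemWeighted U (testL2 hψ hc) := by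
  have hm : AEStronglyMeasurable (fun x => ((√(U x) : ℝ) : ℂ) * (ψ x : ℂ))
      (volume : Measure R3) :=
    (Complex.continuous_ofReal.comp_aestronglyMeasurable
      (Real.continuous_sqrt.comp_aestronglyMeasurable hloc.aestronglyMeasurable)).mul
      (memLp_test hψ hc).1
  have h : MemLp (fun x => ((√(U x) : ℝ) : ℂ) * (ψ x : ℂ)) 2 (volume : Measure R3) := by
    rw [memLp_two_iff_integrable_sq_norm hm]
    refine (hloc.integrable_smul_left_of_hasCompactSupport (hψ.mul hψ)
      (hc.mul_left (f := ψ))).congr (Filter.Eventually.of_forall fun x => ?_)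
    simp only [Pi.mul_apply, smul_eq_mul, norm_mul, Complex.norm_real, mul_pow, Real.norm_eq_abs, sq_abs,
      Real.sq_sqrt (hU x)]
    ring
  refine h.ae_eq ?_
  filter_upwards [(memLp_test hψ hc).coeFn_toLp] with x hx
  rw [testL2, hx]

/-- The graph is single-valued, so that `toLinearPMap` has it as its graph: for `u = 0` the form
vanishes, hence `g` is orthogonal to all test functions. -/
theorem eq_zero_of_mem_schrodingerGraph {U : R3 → ℝ} (hU : ∀ x, 0 ≤ U x)
    (hloc : LocallyIntegrable U (volume : Measure R3)) (p : L2 × L2)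
    (hp : p ∈ schrodingerGraph U) (h0 : p.1 = 0) : p.2 = 0 := by
  obtain ⟨G, hG, -, h⟩ := hp
  have hG0 : ∀ i, G i = 0 := fun i => L2_eq_zero_of_integral_smul fun ψ hψ hc => by
    have := hG i ψ hψ hc
    rw [h0, ← inner_testL2 (continuous_partial hψ i) (hasCompactSupport_partial hc i),
      inner_zero_right] at this
    exact neg_eq_zero.1 this.symm
  refine L2_eq_zero_of_integral_smul fun ψ hψ hc => ?_
  have h1 := h _ _ (isWeakGradient_testL2 hψ hc) (memWeighted_testL2 hU hloc hψ.continuous hc)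
  have h2 := potentialForm_smul (U := U) (w := testL2 hψ.continuous hc) (u := 0) 0
  rw [zero_smul, zero_mul] at h2
  rw [← inner_testL2 hψ.continuous hc, ← h1, h0, h2]
  simp [hG0]

theorem mem_graph_schrodinger {U : R3 → ℝ} (hU : ∀ x, 0 ≤ U x)
    (hloc : LocallyIntegrable U (volume : Measure R3)) (u : (schrodinger U).domain) :
    ((u : L2), schrodinger U u) ∈ schrodingerGraph U :=
  Submodule.mem_graph_toLinearPMap (eq_zero_of_mem_schrodingerGraph hU hloc) u

theorem schrodinger_apply_of_mem {U : R3 → ℝ} (hU : ∀ x, 0 ≤ U x)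
    (hloc : LocallyIntegrable U (volume : Measure R3)) {u g : L2}
    (h : (u, g) ∈ schrodingerGraph U) :
    ∃ hu : u ∈ (schrodinger U).domain, schrodinger U ⟨u, hu⟩ = g := by
  have hu : u ∈ (schrodinger U).domain := ⟨(u, g), h, rfl⟩
  refine ⟨hu, ?_⟩
  have h1 := sub_mem (mem_graph_schrodinger hU hloc ⟨u, hu⟩) h
  exact sub_eq_zero.1 (eq_zero_of_mem_schrodingerGraph hU hloc _ h1 (sub_self u))

theorem potentialForm_conj (U : R3 → ℝ) (w u : L2) :
    conj (potentialForm U w u) = potentialForm U u w := by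
  unfold potentialForm
  rw [← integral_conj]
  refine integral_congr_ae (Filter.Eventually.of_forall fun x => ?_)
  simp only [map_mul, Complex.conj_conj]
  ring

theorem potentialForm_self {U : R3 → ℝ} (hU : ∀ x, 0 ≤ U x) (u : L2) :
    potentialForm U u u = ((∫ x, U x * ‖u x‖ ^ 2 : ℝ) : ℂ) := by
  unfold potentialForm
  rw [← integral_complex_ofReal]
  refine integral_congr_ae (Filter.Eventually.of_forall fun x => ?_)
  change conj (((√(U x) : ℝ) : ℂ) * u x) * (((√(U x) : ℝ) : ℂ) * u x)
    = ((U x * ‖u x‖ ^ 2 : ℝ) : ℂ)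
  rw [← Complex.normSq_eq_conj_mul_self, Complex.normSq_eq_norm_sq, norm_mul, mul_pow,
    Complex.norm_real, Real.norm_eq_abs, sq_abs, Real.sq_sqrt (hU x)]

theorem schrodinger_symm {U : R3 → ℝ} (hU : ∀ x, 0 ≤ U x)
    (hloc : LocallyIntegrable U (volume : Measure R3)) (u w : (schrodinger U).domain) :
    ⟪schrodinger U u, (w : L2)⟫_ℂ = ⟪(u : L2), schrodinger U w⟫_ℂ := by
  obtain ⟨G, hG, hGU, h1⟩ := mem_graph_schrodinger hU hloc u
  obtain ⟨H, hH, hHU, h2⟩ := mem_graph_schrodinger hU hloc w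
  rw [← inner_conj_symm, ← h1 _ _ hH hHU, ← h2 _ _ hG hGU, map_add, potentialForm_conj, map_sum]
  simp only [inner_conj_symm]

/-! #### The form domain as a Hilbert space -/

/-- The ambient Hilbert space of the triples `(u, √U u, ∇u)`. -/
abbrev FormSpace : Type := PiLp 2 (fun _ : Option (Option (Fin 3)) => L2)

/-- The triples `(u, √U u, ∇u)` with `u ∈ H¹ ∩ L²_U`. -/
def formGraph (U : R3 → ℝ) : Submodule ℂ FormSpace where
  carrier := {p | IsWeakGradient (p none) (fun i => p (some (some i))) ∧
    p (some none) =ᵐ[volume] fun x => ((√(U x) : ℝ) : ℂ) * p none x}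
  zero_mem' := by
    refine ⟨?_, ?_⟩
    · intro i ψ _ _
      rw [integral_eq_zero_of_ae, integral_eq_zero_of_ae, neg_zero] <;>
        exact Filter.Eventually.of_forall fun x => by simp
    · filter_upwards [Lp.coeFn_zero ℂ 2 (volume : Measure R3)] with x hx
      change (0 : L2) x = ((√(U x) : ℝ) : ℂ) * (0 : L2) x
      rw [hx, Pi.zero_apply, mul_zero]
  add_mem' := by
    rintro p q ⟨h1, h2⟩ ⟨h1', h2'⟩
    refine ⟨h1.add h1', ?_⟩
    filter_upwards [h2, h2', Lp.coeFn_add (p none) (q none),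
      Lp.coeFn_add (p (some none)) (q (some none))] with x e1 e2 e3 e4
    change (p (some none) + q (some none) : L2) x
      = ((√(U x) : ℝ) : ℂ) * (p none + q none : L2) x
    rw [e3, e4, Pi.add_apply, Pi.add_apply, e1, e2, mul_add]
  smul_mem' := by
    rintro c p ⟨h1, h2⟩
    refine ⟨h1.smul c, ?_⟩
    filter_upwards [h2, Lp.coeFn_smul c (p none), Lp.coeFn_smul c (p (some none))] with x e1 e3 e4
    change (c • p (some none) : L2) x = ((√(U x) : ℝ) : ℂ) * (c • p none : L2) x
    rw [e3, e4, Pi.smul_apply, Pi.smul_apply, e1, smul_eq_mul, smul_eq_mul]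
    ring

theorem isClosed_weakGradient : IsClosed {p : FormSpace |
    IsWeakGradient (p none) (fun i => p (some (some i)))} := by
  have : {p : FormSpace | IsWeakGradient (p none) (fun i => p (some (some i)))}
      = ⋂ (i : Fin 3) (ψ : R3 → ℝ) (hψ : ContDiff ℝ (⊤ : ℕ∞) ψ) (hc : HasCompactSupport ψ),
        {p : FormSpace | ⟪testL2 (continuous_partial hψ i) (hasCompactSupport_partial hc i),
          p none⟫_ℂ = -⟪testL2 hψ.continuous hc, p (some (some i))⟫_ℂ} := by
    ext p
    simp only [Set.mem_iInter, inner_testL2]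
    rfl
  rw [this]
  refine isClosed_iInter fun i => isClosed_iInter fun ψ => isClosed_iInter fun hψ =>
    isClosed_iInter fun hc => isClosed_eq ?_ ?_ <;> fun_prop

/-- No bound on `m` is assumed; `L²` limits are compared pointwise along a common subsequence
converging almost everywhere in both components. -/
theorem isClosed_multiplicationGraph (m : R3 → ℂ) : IsClosed {p : L2 × L2 |
    p.2 =ᵐ[volume] fun x => m x * p.1 x} := by
  refine IsSeqClosed.isClosed fun p q hp hq => ?_
  have h1 := (continuous_fst.tendsto q).comp hq
  have h2 := (continuous_snd.tendsto q).comp hq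
  obtain ⟨n₁, hn₁, e1⟩ := (tendstoInMeasure_of_tendsto_Lp h1).exists_seq_tendsto_ae
  obtain ⟨n₂, hn₂, e2⟩ := (tendstoInMeasure_of_tendsto_Lp
    (h2.comp hn₁.tendsto_atTop)).exists_seq_tendsto_ae
  filter_upwards [e1, e2, ae_all_iff.2 hp] with x h3 h4 h5
  refine tendsto_nhds_unique h4 ?_
  refine ((h3.comp hn₂.tendsto_atTop).const_mul (m x)).congr fun i => ?_
  exact (h5 (n₁ (n₂ i))).symm

theorem isClosed_formGraph (U : R3 → ℝ) : IsClosed (formGraph U : Set FormSpace) := by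
  have h : Continuous fun p : FormSpace => (p none, p (some none)) := by fun_prop
  exact isClosed_weakGradient.inter
    ((isClosed_multiplicationGraph fun x => ((√(U x) : ℝ) : ℂ)).preimage h)

/-- The Riesz argument for `-Δ + U + 1`: the triples `(u, √U u, ∇u)` form a closed subspace whose
inner product is the form of this operator. The projection of `(g, 0, 0)` onto it is therefore the
weak solution of `(-Δ + U + 1) u = g`. -/
theorem exists_schrodinger_add_one {U : R3 → ℝ} (g : L2) :
    ∃ u : L2, (u, g - u) ∈ schrodingerGraph U := by
  have : CompleteSpace (formGraph U) := (isClosed_formGraph U).completeSpace_coe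
  let g' : FormSpace := WithLp.toLp 2 (fun i => Option.elim i g fun _ => 0)
  let p := (formGraph U).starProjection g'
  have hp : p ∈ formGraph U := Submodule.starProjection_apply_mem _ _
  have hmem : ∀ u : L2, ∀ q : L2, q =ᵐ[volume] (fun x => ((√(U x) : ℝ) : ℂ) * u x) →
      MemWeighted U u := fun u q hq => (Lp.memLp q).ae_eq hq
  refine ⟨p none, fun i => p (some (some i)), hp.1, hmem _ _ hp.2, fun w H hw hwU => ?_⟩
  let w' : FormSpace := WithLp.toLp 2 (fun i => Option.elim i w
    fun j => Option.elim j (MemLp.toLp _ hwU) H)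
  have hw' : w' ∈ formGraph U := ⟨hw, MemLp.coeFn_toLp hwU⟩
  have h1 : ⟪w', p⟫_ℂ = ⟪w', g'⟫_ℂ := by
    have := (Submodule.mem_orthogonal _ _).1
      (Submodule.sub_starProjection_mem_orthogonal (K := formGraph U) g') w' hw'
    rw [inner_sub_right, sub_eq_zero] at this
    exact this.symm
  have h2 : ⟪(MemLp.toLp _ hwU : L2), p (some none)⟫_ℂ = potentialForm U w (p none) := by
    rw [inner_L2_eq, potentialForm]
    apply integral_congr_ae
    filter_upwards [hp.2, MemLp.coeFn_toLp hwU] with x h3 h4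
    rw [h3, h4]
  rw [PiLp.inner_apply, PiLp.inner_apply, Fintype.sum_option, Fintype.sum_option,
    Fintype.sum_option, Fintype.sum_option] at h1
  have h3 : ⟪w, p none⟫_ℂ + (⟪(MemLp.toLp _ hwU : L2), p (some none)⟫_ℂ
      + ∑ i, ⟪H i, p (some (some i))⟫_ℂ) = ⟪w, g⟫_ℂ := by
    refine h1.trans ?_
    simp [w', g']
  rw [inner_sub_right, ← h3, h2]
  ring

theorem isSelfAdjointPMap_schrodinger {U : R3 → ℝ} (hU : ∀ x, 0 ≤ U x)
    (hloc : LocallyIntegrable U (volume : Measure R3)) : IsSelfAdjointPMap (schrodinger U) := by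
  refine IsSelfAdjointPMap.of_surjective (schrodinger_symm hU hloc) 1 fun z => ?_
  obtain ⟨u, hu⟩ := exists_schrodinger_add_one (U := U) z
  obtain ⟨hd, e⟩ := schrodinger_apply_of_mem hU hloc hu
  refine ⟨⟨u, hd⟩, ?_⟩
  rw [e, Complex.ofReal_one, one_smul, sub_add_cancel]

/-! ### Complex conjugation of Schrödinger operators -/

theorem IsWeakGradient.star {u : L2} {G : Fin 3 → L2} (h : IsWeakGradient u G) :
    IsWeakGradient (star u) (fun i => star (G i)) := by
  intro i ψ hψ hc
  have key : ∀ (χ : R3 → ℝ) (w : L2), ∫ x, χ x • (Star.star w : L2) x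
      = conj (∫ x, χ x • w x) := by
    intro χ w
    rw [← integral_conj]
    apply integral_congr_ae
    filter_upwards [Lp.coeFn_star w] with x hx
    rw [hx, Complex.real_smul, Complex.real_smul, map_mul, Complex.conj_ofReal]
    rfl
  rw [key, key, h i ψ hψ hc, map_neg]

theorem MemWeighted.star {U : R3 → ℝ} {u : L2} (h : MemWeighted U u) :
    MemWeighted U (star u) := by
  refine (MemLp.star h).ae_eq ?_
  filter_upwards [Lp.coeFn_star u] with x hx
  rw [hx]
  simp

theorem potentialForm_star (U : R3 → ℝ) (w u : L2) :
    potentialForm U w (star u) = conj (potentialForm U (star w) u) := by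
  unfold potentialForm
  rw [← integral_conj]
  apply integral_congr_ae
  filter_upwards [Lp.coeFn_star u, Lp.coeFn_star w] with x hu hw
  rw [hu, hw]
  simp

theorem inner_star_right (a b : L2) : ⟪a, star b⟫_ℂ = conj ⟪star a, b⟫_ℂ := by
  rw [← inner_star_star, star_star]

theorem star_mem_schrodingerGraph {U : R3 → ℝ} {u g : L2} (h : (u, g) ∈ schrodingerGraph U) :
    (star u, star g) ∈ schrodingerGraph U := by
  obtain ⟨G, hG, hU, h1⟩ := h
  refine ⟨fun i => star (G i), hG.star, hU.star, fun w H hw hwU => ?_⟩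
  have := congrArg conj (h1 _ _ hw.star hwU.star)
  rw [inner_star_right, ← this, map_add, map_sum, potentialForm_star]
  simp only [inner_star_right]

/-! ### The effective potential and the Hartree operator -/

section Hartree

variable {V v : R3 → ℝ} {N : ℕ} {φ : L2} {C : ℝ}

theorem convolution_nonneg (hv : ∀ x, 0 ≤ v x) (x : R3) :
    0 ≤ (N : ℝ) * ∫ y, v (x - y) * ‖φ y‖ ^ 2 :=
  mul_nonneg (Nat.cast_nonneg _)
    (integral_nonneg fun _ => mul_nonneg (hv _) (sq_nonneg _))

theorem le_effectivePotential (hv : ∀ x, 0 ≤ v x) (x : R3) :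
    V x ≤ effectivePotential V v N φ x :=
  le_add_of_nonneg_right (convolution_nonneg hv x)

theorem integrable_norm_sq_L2 (u : L2) : Integrable (fun x => ‖u x‖ ^ 2) (volume : Measure R3) :=
  (memLp_two_iff_integrable_sq_norm (Lp.aestronglyMeasurable u)).1 (Lp.memLp u)

/-- The convolution `v ∗ |φ|²` is bounded by `C ‖φ‖²`, so it adds only a bounded term to `V`. -/
theorem locallyIntegrable_effectivePotential
    (hVloc : LocallyIntegrable V (volume : Measure R3)) (hv : ∀ x, 0 ≤ v x)
    (hvm : AEStronglyMeasurable v (volume : Measure R3)) (hC : ∀ x, v x ≤ C) :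
    LocallyIntegrable (effectivePotential V v N φ) (volume : Measure R3) := by
  have hm : AEStronglyMeasurable (fun z : R3 × R3 => v (z.1 - z.2) * ‖φ z.2‖ ^ 2)
      ((volume : Measure R3).prod volume) :=
    (hvm.comp_quasiMeasurePreserving (quasiMeasurePreserving_sub volume volume)).mul
      ((Lp.aestronglyMeasurable φ).comp_snd.norm.pow 2)
  have hb : ∀ x, ‖∫ y, v (x - y) * ‖φ y‖ ^ 2‖ ≤ ∫ y, C * ‖φ y‖ ^ 2 := fun x =>
    norm_integral_le_of_norm_le ((integrable_norm_sq_L2 φ).const_mul C)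
      (Filter.Eventually.of_forall fun y => by
        rw [Real.norm_of_nonneg (mul_nonneg (hv _) (sq_nonneg _))]
        exact mul_le_mul_of_nonneg_right (hC _) (sq_nonneg _))
  have h1 : LocallyIntegrable (fun x => ∫ y, v (x - y) * ‖φ y‖ ^ 2) (volume : Measure R3) :=
    (memLp_top_of_bound hm.integral_prod_right' _
      (Filter.Eventually.of_forall hb)).locallyIntegrable le_top
  exact hVloc.add (h1.smul (N : ℝ))

/-- Operator domains are defined with the effective potential and the coercivity condition with `V`;
since `V` is the smaller one, coercivity applies to domain vectors. -/
theorem MemWeighted.mono {U : R3 → ℝ} (hVm : AEStronglyMeasurable V (volume : Measure R3))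
    (hVU : ∀ x, V x ≤ U x) {u : L2} (h : MemWeighted U u) : MemWeighted V u := by
  refine MemLp.mono h ((Complex.continuous_ofReal.comp_aestronglyMeasurable
    (Real.continuous_sqrt.comp_aestronglyMeasurable hVm)).mul (Lp.aestronglyMeasurable u))
    (Filter.Eventually.of_forall fun x => ?_)
  rw [norm_mul, norm_mul, Complex.norm_real, Complex.norm_real,
    Real.norm_of_nonneg (Real.sqrt_nonneg _), Real.norm_of_nonneg (Real.sqrt_nonneg _)]
  exact mul_le_mul_of_nonneg_right (Real.sqrt_le_sqrt (hVU x)) (norm_nonneg _)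

end Hartree

/-! ### Compression to the orthogonal complement of a vector -/

/-- As `φ ∈ dom T`, the projection to `φ^⊥` preserves `dom T`; a test on `dom T ∩ φ^⊥` therefore
extends to all of `dom T`. -/
theorem isSelfAdjointPMap_compressPMap {T : L2 →ₗ.[ℂ] L2} (hT : IsSelfAdjointPMap T) {φ : L2}
    (hφ : φ ∈ T.domain) (hn : ‖φ‖ = 1) : IsSelfAdjointPMap (compressPMap (Perp φ) T) := by
  have happ : ∀ x : (compressPMap (Perp φ) T).domain, compressPMap (Perp φ) T x
      = (Perp φ).orthogonalProjectionOnto (T ⟨((x : Perp φ) : L2), x.2⟩) := fun x => rfl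
  have hort : ∀ y : Perp φ, ⟪φ, (y : L2)⟫_ℂ = 0 := fun y =>
    Submodule.mem_orthogonal_singleton_iff_inner_right.1 y.2
  have hl : ∀ (x : L2) (y : Perp φ), ⟪(Perp φ).orthogonalProjectionOnto x, y⟫_ℂ = ⟪x, (y : L2)⟫_ℂ :=
    fun x y => Submodule.inner_orthogonalProjectionOnto_eq_of_mem_right y x
  have hr : ∀ (x : L2) (y : Perp φ), ⟪y, (Perp φ).orthogonalProjectionOnto x⟫_ℂ = ⟪(y : L2), x⟫_ℂ :=
    fun x y => Submodule.inner_orthogonalProjectionOnto_eq_of_mem_left y x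
  refine ⟨fun x y => ?_, fun y z h => ?_⟩
  · rw [happ, happ, hl, hr]
    exact hT.symm ⟨_, x.2⟩ ⟨_, y.2⟩
  -- Testing with `x - ⟪φ, x⟫ φ` leaves the defect `⟪x, φ⟫ ⟪T φ, y⟫`. The multiple of `φ` added to
  -- `z` absorbs it and disappears under the projection.
  · obtain ⟨hy, e⟩ := hT.maximal y ((z : L2) + ⟪T ⟨φ, hφ⟩, (y : L2)⟫_ℂ • φ) (fun x => by
      have hx' : (x : L2) - ⟪φ, (x : L2)⟫_ℂ • φ ∈ T.domain :=
        sub_mem x.2 (T.domain.smul_mem _ hφ)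
      have hp : (x : L2) - ⟪φ, (x : L2)⟫_ℂ • φ ∈ Perp φ := by
        rw [Submodule.mem_orthogonal_singleton_iff_inner_right, inner_sub_right, inner_smul_right,
          inner_self_eq_norm_sq_to_K, hn]
        simp
      have e1 := h ⟨⟨_, hp⟩, hx'⟩
      rw [happ, hl] at e1
      have e2 : T ⟨_, hx'⟩ = T x - ⟪φ, (x : L2)⟫_ℂ • T ⟨φ, hφ⟩ := by
        rw [← T.map_smul, ← T.map_sub]
        rfl
      have e3 : ⟪T x - ⟪φ, (x : L2)⟫_ℂ • T ⟨φ, hφ⟩, (y : L2)⟫_ℂ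
          = ⟪(x : L2) - ⟪φ, (x : L2)⟫_ℂ • φ, (z : L2)⟫_ℂ := by
        rw [← e2]
        exact e1
      rw [inner_sub_left, inner_sub_left, inner_smul_left, inner_smul_left, hort, mul_zero,
        sub_zero, inner_conj_symm, sub_eq_iff_eq_add] at e3
      rw [e3, inner_add_right, inner_smul_right]
      ring)
    refine ⟨hy, ?_⟩
    rw [happ]
    refine ext_inner_right ℂ fun w => ?_
    rw [hl]
    change ⟪T ⟨(y : L2), hy⟩, (w : L2)⟫_ℂ = ⟪(z : L2), (w : L2)⟫_ℂ
    rw [e, inner_add_left, inner_smul_left, hort, mul_zero, add_zero]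

/-! ### Bounded blocks, and complex conjugation between `φ^⊥` and `φ̄^⊥` -/

section Blocks

variable {S T : Submodule ℂ L2} [T.HasOrthogonalProjection]

theorem inner_block_left (A : L2 →L[ℂ] L2) (s : S) (t : T) :
    ⟪block S T A s, t⟫_ℂ = ⟪A s, (t : L2)⟫_ℂ :=
  Submodule.inner_orthogonalProjectionOnto_eq_of_mem_right t (A s)

theorem inner_block_right (A : L2 →L[ℂ] L2) (s : S) (t : T) :
    ⟪t, block S T A s⟫_ℂ = ⟪(t : L2), A s⟫_ℂ :=
  Submodule.inner_orthogonalProjectionOnto_eq_of_mem_left t (A s)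

theorem norm_block_le (A : L2 →L[ℂ] L2) : ‖block S T A‖ ≤ ‖A‖ :=
  ContinuousLinearMap.opNorm_le_bound _ (norm_nonneg _) fun s =>
    (T.norm_orthogonalProjectionOnto_apply_le (A s)).trans (A.le_opNorm s)

theorem coe_block_of_mem {A : L2 →L[ℂ] L2} {s : S} (h : A s ∈ T) : (block S T A s : L2) = A s :=
  T.starProjection_eq_self_iff.2 h

end Blocks

theorem star_mem_perp {φ e : L2} (he : e ∈ Perp φ) : star e ∈ Perp (star φ) :=
  (conjPerp φ ⟨e, he⟩).2

theorem star_mem_perp' {φ e : L2} (he : e ∈ Perp (star φ)) : star e ∈ Perp φ := by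
  have := star_mem_perp he
  rwa [star_star] at this

theorem star_orthogonalProjectionOnto (φ x : L2) :
    star ((Perp φ).orthogonalProjectionOnto x : L2)
      = (Perp (star φ)).orthogonalProjectionOnto (star x) := by
  refine (Submodule.eq_starProjection_of_mem_of_inner_eq_zero
    (star_mem_perp (Submodule.coe_mem _)) fun w hw => ?_).symm
  rw [← star_sub_L2, ← star_star w, inner_star_star]
  have := Submodule.starProjection_inner_eq_zero (K := Perp φ) x (star w) (star_mem_perp' hw)
  rw [Submodule.starProjection_apply] at this
  rw [this, map_zero]

/-- It removes the projections between factors, so that compositions of blocks agree with blocks of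
compositions. -/
theorem apply_orthogonalProjectionOnto_perp {φ : L2} {A : L2 →L[ℂ] L2} (hA : A φ = 0) (x : L2) :
    A ((Perp φ).orthogonalProjectionOnto x) = A x := by
  have h1 : x - (Perp φ).starProjection x ∈ (ℂ ∙ φ) := by
    have := Submodule.sub_starProjection_mem_orthogonal (K := Perp φ) x
    rwa [Submodule.orthogonal_orthogonal] at this
  obtain ⟨a, ha⟩ := Submodule.mem_span_singleton.1 h1
  have h2 := congrArg A ha
  rw [map_smul, hA, smul_zero, map_sub] at h2
  exact (sub_eq_zero.1 h2.symm).symm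

/-! ### The one-particle operators on the orthogonal complement of the condensate -/

section OneParticle

variable {V v : R3 → ℝ} {N : ℕ} {μ : ℝ} {φ : L2} {k : L2 →L[ℂ] L2} {c C : ℝ}

theorem star_mem_domain_hartreeOp (hV : ∀ x, 0 ≤ V x)
    (hVloc : LocallyIntegrable V (volume : Measure R3)) (hv : ∀ x, 0 ≤ v x)
    (hvm : AEStronglyMeasurable v (volume : Measure R3)) (hC : ∀ x, v x ≤ C)
    {u : L2} (hu : u ∈ (hartreeOp V v N φ).domain) :
    ∃ h : star u ∈ (hartreeOp V v N φ).domain,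
      hartreeOp V v N φ ⟨star u, h⟩ = star (hartreeOp V v N φ ⟨u, hu⟩) := by
  have hU : ∀ x, 0 ≤ effectivePotential V v N φ x := fun x =>
    (hV x).trans (le_effectivePotential hv x)
  have hloc := locallyIntegrable_effectivePotential (N := N) (φ := φ) hVloc hv hvm hC
  exact schrodinger_apply_of_mem hU hloc
    (star_mem_schrodingerGraph (mem_graph_schrodinger hU hloc ⟨u, hu⟩))

theorem isSelfAdjointPMap_hartreeOp (hV : ∀ x, 0 ≤ V x)
    (hVloc : LocallyIntegrable V (volume : Measure R3)) (hv : ∀ x, 0 ≤ v x)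
    (hvm : AEStronglyMeasurable v (volume : Measure R3)) (hC : ∀ x, v x ≤ C) :
    IsSelfAdjointPMap (hartreeOp V v N φ) :=
  isSelfAdjointPMap_schrodinger (fun x => (hV x).trans (le_effectivePotential hv x))
    (locallyIntegrable_effectivePotential hVloc hv hvm hC)

theorem memLp_gammaKernel_swap (hv : ∀ x, 0 ≤ v x) (hvsymm : ∀ x, v (-x) = v x)
    (hvm : AEStronglyMeasurable v (volume : Measure R3)) (hC : ∀ x, v x ≤ C) :
    MemLp (fun z => gammaKernel v φ z.swap) 2 ((volume : Measure R3).prod volume) := by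
  simp only [gammaKernel_swap φ hvsymm]
  exact (memLp_gammaKernel φ hv hvm hC).star

theorem memLp_fKernel_conj (hv : ∀ x, 0 ≤ v x)
    (hvm : AEStronglyMeasurable v (volume : Measure R3)) (hC : ∀ x, v x ≤ C) :
    MemLp (fun z => conj (fKernel v N φ z)) 2 ((volume : Measure R3).prod volume) :=
  (memLp_fKernel N φ hv hvm hC).star

theorem isSelfAdjointPMap_vadd_kernelOp {A : L2 →ₗ.[ℂ] L2} (hA : IsSelfAdjointPMap A)
    {K : R3 × R3 → ℂ} (hK : MemLp K 2 ((volume : Measure R3).prod volume))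
    (h : ∀ z, K z = conj (K z.swap)) (N : ℕ) (μ : ℝ) :
    IsSelfAdjointPMap ((((N : ℂ) • kernelOp K - (μ : ℂ) • ContinuousLinearMap.id ℂ L2 :
      L2 →L[ℂ] L2) : L2 →ₗ[ℂ] L2) +ᵥ A) := by
  refine hA.vadd _ fun x y => ?_
  simp only [sub_apply, smul_apply,
    ContinuousLinearMap.id_apply, inner_sub_left, inner_sub_right, inner_smul_left,
    inner_smul_right, inner_kernelOp_left hK hK h, Complex.conj_ofReal, map_natCast]

theorem isSelfAdjointPMap_hOp (hV : ∀ x, 0 ≤ V x)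
    (hVloc : LocallyIntegrable V (volume : Measure R3)) (hv : ∀ x, 0 ≤ v x)
    (hvsymm : ∀ x, v (-x) = v x)
    (hvm : AEStronglyMeasurable v (volume : Measure R3)) (hC : ∀ x, v x ≤ C) :
    IsSelfAdjointPMap (hOp V v N μ φ) :=
  isSelfAdjointPMap_vadd_kernelOp (isSelfAdjointPMap_hartreeOp hV hVloc hv hvm hC)
    (memLp_gammaKernel φ hv hvm hC)
    (fun z => by rw [gammaKernel_swap φ hvsymm, Complex.conj_conj]) N μ

theorem isSelfAdjointPMap_hTOp (hV : ∀ x, 0 ≤ V x)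
    (hVloc : LocallyIntegrable V (volume : Measure R3)) (hv : ∀ x, 0 ≤ v x)
    (hvsymm : ∀ x, v (-x) = v x)
    (hvm : AEStronglyMeasurable v (volume : Measure R3)) (hC : ∀ x, v x ≤ C) :
    IsSelfAdjointPMap (hTOp V v N μ φ) :=
  isSelfAdjointPMap_vadd_kernelOp (isSelfAdjointPMap_hartreeOp hV hVloc hv hvm hC)
    (memLp_gammaKernel_swap hv hvsymm hvm hC)
    (fun z => by rw [gammaKernel_swap φ hvsymm, Prod.swap_swap]) N μ

/-- `hᵀ` is the complex conjugate of `h`. -/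
theorem hTOp_star (hV : ∀ x, 0 ≤ V x)
    (hVloc : LocallyIntegrable V (volume : Measure R3)) (hv : ∀ x, 0 ≤ v x)
    (hvsymm : ∀ x, v (-x) = v x)
    (hvm : AEStronglyMeasurable v (volume : Measure R3)) (hC : ∀ x, v x ≤ C)
    {u : L2} (hu : u ∈ (hOp V v N μ φ).domain) :
    ∃ h : star u ∈ (hTOp V v N μ φ).domain,
      hTOp V v N μ φ ⟨star u, h⟩ = star (hOp V v N μ φ ⟨u, hu⟩) := by
  obtain ⟨h, e⟩ := star_mem_domain_hartreeOp hV hVloc hv hvm hC (N := N) (φ := φ) hu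
  refine ⟨h, ?_⟩
  change ((N : ℂ) • kernelOp (fun z => gammaKernel v φ z.swap) (star u) - (μ : ℂ) • star u)
      + hartreeOp V v N φ ⟨star u, h⟩
    = star (((N : ℂ) • kernelOp (gammaKernel v φ) u - (μ : ℂ) • u)
      + hartreeOp V v N φ ⟨u, hu⟩)
  rw [e, star_add_L2, star_sub_L2, star_smul_L2, star_smul_L2, Complex.conj_ofReal, map_natCast,
    star_kernelOp (memLp_gammaKernel φ hv hvm hC) (memLp_gammaKernel_swap hv hvsymm hvm hC)
      (gammaKernel_swap φ hvsymm)]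

theorem hTPerp_conj (hV : ∀ x, 0 ≤ V x)
    (hVloc : LocallyIntegrable V (volume : Measure R3)) (hv : ∀ x, 0 ≤ v x)
    (hvsymm : ∀ x, v (-x) = v x)
    (hvm : AEStronglyMeasurable v (volume : Measure R3)) (hC : ∀ x, v x ≤ C)
    {u : Perp φ} (hu : u ∈ (hPerp V v N μ φ).domain) :
    ∃ h : conjPerp φ u ∈ (hTPerp V v N μ φ).domain,
      hTPerp V v N μ φ ⟨conjPerp φ u, h⟩ = conjPerp φ (hPerp V v N μ φ ⟨u, hu⟩) := by
  obtain ⟨h, e⟩ := hTOp_star hV hVloc hv hvsymm hvm hC (N := N) (μ := μ) (φ := φ)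
    (u := (u : L2)) hu
  refine ⟨h, Subtype.ext ?_⟩
  change ((Perp (star φ)).orthogonalProjectionOnto (hTOp V v N μ φ ⟨star (u : L2), h⟩) : L2)
    = star ((Perp φ).orthogonalProjectionOnto (hOp V v N μ φ ⟨u, hu⟩) : L2)
  rw [e, star_orthogonalProjectionOnto]

theorem mem_hPerp_of_conj (hV : ∀ x, 0 ≤ V x)
    (hVloc : LocallyIntegrable V (volume : Measure R3)) (hv : ∀ x, 0 ≤ v x)
    (hvm : AEStronglyMeasurable v (volume : Measure R3)) (hC : ∀ x, v x ≤ C)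
    {u : Perp φ} (hu : conjPerp φ u ∈ (hTPerp V v N μ φ).domain) :
    u ∈ (hPerp V v N μ φ).domain := by
  obtain ⟨h, -⟩ := star_mem_domain_hartreeOp hV hVloc hv hvm hC (N := N) (φ := φ)
    (u := star (u : L2)) hu
  rw [star_star] at h
  exact h

theorem exists_conjPerp (y : Perp (star φ)) : ∃ x : Perp φ, conjPerp φ x = y :=
  ⟨⟨star (y : L2), star_mem_perp' y.2⟩, Subtype.ext (star_star _)⟩

/-- The quadratic form of `h` on the domain of `h`. -/
theorem re_inner_hOp (hV : ∀ x, 0 ≤ V x)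
    (hVloc : LocallyIntegrable V (volume : Measure R3)) (hv : ∀ x, 0 ≤ v x)
    (hvm : AEStronglyMeasurable v (volume : Measure R3)) (hC : ∀ x, v x ≤ C)
    (u : (hOp V v N μ φ).domain) : ∃ G, IsWeakGradient (u : L2) G ∧ MemWeighted V (u : L2) ∧
      RCLike.re ⟪(u : L2), hOp V v N μ φ u⟫_ℂ = hForm V v N μ φ u G := by
  have hU : ∀ x, 0 ≤ effectivePotential V v N φ x := fun x =>
    (hV x).trans (le_effectivePotential hv x)
  have hloc := locallyIntegrable_effectivePotential (N := N) (φ := φ) hVloc hv hvm hC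
  obtain ⟨G, hG, hGU, h⟩ := mem_graph_schrodinger hU hloc ⟨u, u.2⟩
  refine ⟨G, hG, hGU.mono hVloc.aestronglyMeasurable (le_effectivePotential hv), ?_⟩
  have h1 := h _ _ hG hGU
  have e : hOp V v N μ φ u = ((N : ℂ) • kernelOp (gammaKernel v φ) u - (μ : ℂ) • (u : L2))
      + schrodinger (effectivePotential V v N φ) ⟨u, u.2⟩ := rfl
  rw [e, inner_add_right, ← h1, potentialForm_self hU, inner_sub_right, inner_smul_right,
    inner_smul_right, inner_self_eq_norm_sq_to_K, hForm]
  simp only [inner_self_eq_norm_sq_to_K]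
  simp only [map_add, map_sub, map_sum, RCLike.re_to_complex, Complex.mul_re,
    Complex.natCast_re, Complex.natCast_im, zero_mul, sub_zero, Complex.ofReal_re,
    Complex.ofReal_im, Complex.coe_algebraMap, ← Complex.ofReal_pow]
  ring

theorem fOp_symm (hv : ∀ x, 0 ≤ v x) (hvsymm : ∀ x, v (-x) = v x)
    (hvm : AEStronglyMeasurable v (volume : Measure R3)) (hC : ∀ x, v x ≤ C) (x y : L2) :
    ⟪fOp v N φ y, x⟫_ℂ = ⟪y, fBarOp v N φ x⟫_ℂ :=
  inner_kernelOp_left (memLp_fKernel N φ hv hvm hC) (memLp_fKernel_conj hv hvm hC)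
    (fun z => by rw [fKernel_swap N φ hvsymm]) y x

theorem star_fOp (hv : ∀ x, 0 ≤ v x)
    (hvm : AEStronglyMeasurable v (volume : Measure R3)) (hC : ∀ x, v x ≤ C) (x : L2) :
    star (fOp v N φ x) = fBarOp v N φ (star x) :=
  star_kernelOp (memLp_fKernel N φ hv hvm hC) (memLp_fKernel_conj hv hvm hC) (fun _ => rfl) x

theorem inner_fOp_star_comm (hv : ∀ x, 0 ≤ v x) (hvsymm : ∀ x, v (-x) = v x)
    (hvm : AEStronglyMeasurable v (volume : Measure R3)) (hC : ∀ x, v x ≤ C) (a b : L2) :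
    ⟪a, fOp v N φ (star b)⟫_ℂ = ⟪b, fOp v N φ (star a)⟫_ℂ := by
  rw [← inner_conj_symm, fOp_symm hv hvsymm hvm hC, ← star_star a, ← star_fOp hv hvm hC,
    inner_star_star, Complex.conj_conj, star_star]

/-- Polarization of the coercivity condition. -/
theorem coercive_pair (hV : ∀ x, 0 ≤ V x)
    (hVloc : LocallyIntegrable V (volume : Measure R3)) (hv : ∀ x, 0 ≤ v x)
    (hvsymm : ∀ x, v (-x) = v x)
    (hvm : AEStronglyMeasurable v (volume : Measure R3)) (hC : ∀ x, v x ≤ C)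
    (hcoer : IsCoerciveWith V v N μ φ c) (a b : (hOp V v N μ φ).domain)
    (ha : ⟪φ, (a : L2)⟫_ℂ = 0) (hb : ⟪φ, (b : L2)⟫_ℂ = 0) :
    c * (‖(a : L2)‖ ^ 2 + ‖(b : L2)‖ ^ 2) ≤ RCLike.re ⟪(a : L2), hOp V v N μ φ a⟫_ℂ
      + RCLike.re ⟪(b : L2), hOp V v N μ φ b⟫_ℂ
      - 2 * RCLike.re ⟪(a : L2), fOp v N φ (star (b : L2))⟫_ℂ := by
  have key : ∀ e : (hOp V v N μ φ).domain, ⟪φ, (e : L2)⟫_ℂ = 0 → c * ‖(e : L2)‖ ^ 2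
      ≤ RCLike.re ⟪(e : L2), hOp V v N μ φ e⟫_ℂ
        - ‖⟪(e : L2), fOp v N φ (star (e : L2))⟫_ℂ‖ := by
    intro e he
    obtain ⟨G, h1, h2, h3⟩ := re_inner_hOp hV hVloc hv hvm hC e
    have := hcoer e G h1 h2 he
    rwa [pairing_eq_inner, star_star, ← h3] at this
  -- In `|f(e, e)|` use `Re f ≤ |f|` for `e = a + b` and `-Re f ≤ |f|` for `e = a - b`. In the sum
  -- the diagonal terms of `f` cancel, and by symmetry of `f` the cross terms add up to `4 Re f(a,
  -- b)`.
  have k1 := key (a + b) (by rw [Submodule.coe_add, inner_add_right, ha, hb, add_zero])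
  have k2 := key (a - b) (by rw [Submodule.coe_sub, inner_sub_right, ha, hb, sub_zero])
  have p := parallelogram_law_with_norm ℂ (a : L2) (b : L2)
  have r1 := RCLike.re_le_norm ⟪((a + b : (hOp V v N μ φ).domain) : L2),
    fOp v N φ (star ((a + b : (hOp V v N μ φ).domain) : L2))⟫_ℂ
  have r2 := neg_le_of_abs_le (RCLike.abs_re_le_norm ⟪((a - b : (hOp V v N μ φ).domain) : L2),
    fOp v N φ (star ((a - b : (hOp V v N μ φ).domain) : L2))⟫_ℂ)
  have hs := inner_fOp_star_comm (N := N) (φ := φ) hv hvsymm hvm hC (b : L2) (a : L2)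
  have k3 := k1.trans (sub_le_sub_left r1 _)
  have k4 := k2.trans ((sub_eq_add_neg _ _).trans_le (add_le_add_right r2 _))
  rw [LinearPMap.map_add] at k3
  rw [LinearPMap.map_sub] at k4
  simp only [Submodule.coe_add, star_add_L2, map_add, inner_add_left, inner_add_right, hs] at k3
  simp only [Submodule.coe_sub, star_sub_L2, map_sub, inner_sub_left, inner_sub_right, hs] at k4
  have p' : c * ‖(a : L2) + (b : L2)‖ ^ 2 + c * ‖(a : L2) - (b : L2)‖ ^ 2
      = 2 * (c * (‖(a : L2)‖ ^ 2 + ‖(b : L2)‖ ^ 2)) := by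
    rw [← mul_add, p]
    ring
  linarith

end OneParticle

/-! ### Complex conjugate operators and their spectra -/

/-- If conjugation carries `A` to `B`, then `y ↦ conj (R ȳ)` is a resolvent of `B` at `conj z`: two
conjugations make it linear again, but they conjugate the scalar `z`. -/
theorem IsResolventAt.conj {S T : Submodule ℂ L2} [T.HasOrthogonalProjection]
    [S.HasOrthogonalProjection] (hST : ∀ x ∈ S, star x ∈ T) (hTS : ∀ x ∈ T, star x ∈ S)
    {A : S →ₗ.[ℂ] S} {B : T →ₗ.[ℂ] T}
    (hAB : ∀ a (ha : a ∈ A.domain), ∃ h : (⟨star (a : L2), hST a a.2⟩ : T) ∈ B.domain,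
      (B ⟨_, h⟩ : L2) = star (A ⟨a, ha⟩ : L2))
    (hBA : ∀ b (hb : b ∈ B.domain), ∃ h : (⟨star (b : L2), hTS b b.2⟩ : S) ∈ A.domain,
      (A ⟨_, h⟩ : L2) = star (B ⟨b, hb⟩ : L2))
    {z : ℂ} {R : S →L[ℂ] S} (h : IsResolventAt A z R) :
    ∃ R', IsResolventAt B (starRingEnd ℂ z) R' := by
  -- `R` is extended by `0` on the complement of `S`, so that `conjOp` on all of `L²` supplies
  -- linearity and boundedness.
  let R' : T →L[ℂ] T := block T T (conjOp (S.subtypeL ∘L R ∘L S.orthogonalProjectionOnto))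
  have hR' : ∀ y : T, R' y = ⟨star (R ⟨star (y : L2), hTS y y.2⟩ : L2), hST _ (R _).2⟩ := by
    intro y
    have e : S.orthogonalProjectionOnto (star (y : L2)) = ⟨star (y : L2), hTS y y.2⟩ :=
      Subtype.ext (S.starProjection_eq_self_iff.2 (hTS y y.2))
    have e1 : conjOp (S.subtypeL ∘L R ∘L S.orthogonalProjectionOnto) (y : L2)
        = star (R ⟨star (y : L2), hTS y y.2⟩ : L2) := by
      rw [← e]
      rfl
    refine Subtype.ext ?_
    change (block T T _ y : L2) = star (R ⟨star (y : L2), hTS y y.2⟩ : L2)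
    rw [coe_block_of_mem (by rw [e1]; exact hST _ (R _).2), e1]
  refine ⟨R', fun y => ?_, fun y => ?_⟩
  · obtain ⟨hx, e⟩ := h.1 ⟨star (y : L2), hTS y y.2⟩
    obtain ⟨hd, e1⟩ := hAB _ hx
    rw [hR']
    refine ⟨hd, Subtype.ext ?_⟩
    rw [Submodule.coe_sub, e1, Submodule.coe_smul, ← star_smul_L2, ← star_sub_L2]
    have e2 := congrArg (fun s : S => star (s : L2)) e
    simpa only [Submodule.coe_sub, Submodule.coe_smul, star_star] using e2
  · obtain ⟨hd, e1⟩ := hBA _ y.2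
    have e2 := h.2 ⟨_, hd⟩
    rw [hR']
    refine Subtype.ext ?_
    have e3 : (⟨star ((B y - starRingEnd ℂ z • (y : T) : T) : L2), hTS _ (Submodule.coe_mem _)⟩ : S)
        = A ⟨_, hd⟩ - z • (⟨star ((y : T) : L2), hTS _ (Submodule.coe_mem _)⟩ : S) := by
      refine Subtype.ext ?_
      change star ((B y : L2) - starRingEnd ℂ z • ((y : T) : L2))
        = (A ⟨_, hd⟩ : L2) - z • star ((y : T) : L2)
      rw [e1, star_sub_L2, star_smul_L2, Complex.conj_conj]
    change star (R _ : L2) = _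
    rw [e3, e2]
    exact star_star _

/-! ### The pair system of the Bose gas -/

section BosePair

variable {V v : R3 → ℝ} {N : ℕ} {μ : ℝ} {φ : L2} {k : L2 →L[ℂ] L2} {c C : ℝ}

/-- The adjoint of `k` is `k̄`, and `k̄ φ = conj (k φ̄) = 0`. -/
theorem apply_mem_perp (hk : transposeOp k = k) (hkφ : k (star φ) = 0) (x : L2) :
    k x ∈ Perp φ := by
  rw [Submodule.mem_orthogonal_singleton_iff_inner_right, ← ContinuousLinearMap.adjoint_inner_left,
    adjoint_eq_conjOp hk, conjOp_apply, hkφ, star_zero_L2, inner_zero_left]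

theorem conjOp_apply_mem_perp (hk : transposeOp k = k) (hkφ : k (star φ) = 0) (x : L2) :
    conjOp k x ∈ Perp (star φ) :=
  star_mem_perp (apply_mem_perp hk hkφ _)

theorem coe_kPerp (hk : transposeOp k = k) (hkφ : k (star φ) = 0) (y : Perp (star φ)) :
    (kPerp φ k y : L2) = k y :=
  coe_block_of_mem (apply_mem_perp hk hkφ _)

theorem coe_kBarPerp (hk : transposeOp k = k) (hkφ : k (star φ) = 0) (y : Perp φ) :
    (kBarPerp φ k y : L2) = conjOp k y :=
  coe_block_of_mem (conjOp_apply_mem_perp hk hkφ _)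

theorem coe_kPerp_fBarPerp (hk : transposeOp k = k) (hkφ : k (star φ) = 0) (x : Perp φ) :
    (kPerp φ k (fBarPerp v N φ x) : L2) = k (fBarOp v N φ x) := by
  rw [coe_kPerp hk hkφ]
  exact apply_orthogonalProjectionOnto_perp hkφ _

theorem coe_kBarPerp_fPerp (hk : transposeOp k = k) (hkφ : k (star φ) = 0)
    (x : Perp (star φ)) : (kBarPerp φ k (fPerp v N φ x) : L2) = conjOp k (fOp v N φ x) := by
  rw [coe_kBarPerp hk hkφ]
  refine apply_orthogonalProjectionOnto_perp ?_ _
  rw [conjOp_apply, hkφ, star_zero_L2]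

/-- The bridge from the Bose gas to the abstract setting: bilinear pairings and conjugates on `L²`
become inner products and adjoints between `φ^⊥` and `φ̄^⊥`. -/
theorem isPairSystem (hV : ∀ x, 0 ≤ V x)
    (hVloc : LocallyIntegrable V (volume : Measure R3)) (hv : ∀ x, 0 ≤ v x)
    (hvsymm : ∀ x, v (-x) = v x)
    (hvm : AEStronglyMeasurable v (volume : Measure R3)) (hC : ∀ x, v x ≤ C)
    (hn : ‖φ‖ = 1) (hφ : φ ∈ (hartreeOp V v N φ).domain) (hc : 0 < c)
    (hcoer : IsCoerciveWith V v N μ φ c) (hk : transposeOp k = k) (hkφ : k (star φ) = 0)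
    (hk1 : ‖k‖ < 1) (hRic : IsRiccatiSolution V v N μ φ k) :
    IsPairSystem (hPerp V v N μ φ) (hTPerp V v N μ φ) (fPerp v N φ) (kPerp φ k)
      (fBarPerp v N φ) (kBarPerp φ k) c where
  left := isSelfAdjointPMap_compressPMap (isSelfAdjointPMap_hOp hV hVloc hv hvsymm hvm hC) hφ hn
  right := isSelfAdjointPMap_compressPMap (isSelfAdjointPMap_hTOp hV hVloc hv hvsymm hvm hC)
    (star_mem_domain_hartreeOp hV hVloc hv hvm hC hφ).1 (by rw [norm_star_L2, hn])
  adjoint_f x y := by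
    rw [fPerp, fBarPerp, inner_block_left, inner_block_right, fOp_symm hv hvsymm hvm hC]
  adjoint_k x y := by
    rw [kPerp, kBarPerp, inner_block_left, inner_block_right, ← adjoint_eq_conjOp hk,
      ContinuousLinearMap.adjoint_inner_right]
  norm_k := (norm_block_le k).trans_lt hk1
  norm_k' := ((norm_block_le _).trans (norm_conjOp_le k)).trans_lt hk1
  c_pos := hc
  coercive a b := by
    -- Write `b` as the conjugate of `b' ∈ φ^⊥`. Then `⟪b, hᵀ b⟫` is the conjugate of `⟪b', h b'⟫`,
    -- and the polarized coercivity applies to `a` and `b'`.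
    obtain ⟨b', hb'⟩ := exists_conjPerp (b : Perp (star φ))
    have hbd : b' ∈ (hPerp V v N μ φ).domain :=
      mem_hPerp_of_conj hV hVloc hv hvm hC (hb' ▸ b.2)
    obtain ⟨h1, e1⟩ := hTPerp_conj hV hVloc hv hvsymm hvm hC hbd
    have e2 : hTPerp V v N μ φ b = conjPerp φ (hPerp V v N μ φ ⟨b', hbd⟩) := by
      rw [← e1]
      congr 1
      exact Subtype.ext hb'.symm
    have hl : ∀ (u : (hPerp V v N μ φ).domain), ⟪(u : Perp φ), hPerp V v N μ φ u⟫_ℂ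
        = ⟪((u : Perp φ) : L2), hOp V v N μ φ ⟨((u : Perp φ) : L2), u.2⟩⟫_ℂ := fun u =>
      Submodule.inner_orthogonalProjectionOnto_eq_of_mem_left (u : Perp φ) _
    have e3 : RCLike.re ⟪(b : Perp (star φ)), hTPerp V v N μ φ b⟫_ℂ
        = RCLike.re ⟪(b' : L2), hOp V v N μ φ ⟨(b' : L2), hbd⟩⟫_ℂ := by
      have e4 : ⟪(b : Perp (star φ)), hTPerp V v N μ φ b⟫_ℂ
          = conj ⟪b', hPerp V v N μ φ ⟨b', hbd⟩⟫_ℂ := by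
        rw [e2, ← hb']
        exact inner_star_star _ _
      rw [e4, RCLike.conj_re, hl ⟨b', hbd⟩]
    have e5 : ((b : Perp (star φ)) : L2) = star (b' : L2) := by
      rw [← hb']
      rfl
    have key := coercive_pair hV hVloc hv hvsymm hvm hC hcoer ⟨_, a.2⟩ ⟨_, hbd⟩
      (Submodule.mem_orthogonal_singleton_iff_inner_right.1 (a : Perp φ).2)
      (Submodule.mem_orthogonal_singleton_iff_inner_right.1 b'.2)
    rw [e3, hl, fPerp, inner_block_right, e5, Submodule.coe_norm, Submodule.coe_norm, e5,
      norm_star_L2]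
    exact key
  riccati a b := by
    obtain ⟨h1, e1⟩ := hTPerp_conj hV hVloc hv hvsymm hvm hC a.2
    -- Testing with `r = ā` turns the pairings into inner products with `a`, and `hᵀ_⊥ ā` is the
    -- conjugate of `h_⊥ a`.
    have h := hRic b ⟨_, h1⟩
    have hp : ∀ x y : L2, pairing x (star y) = ⟪y, x⟫_ℂ := fun x y => by
      rw [pairing_eq_inner, inner_star_star, inner_conj_symm]
    rw [e1] at h
    change pairing _ (star ((a : Perp φ) : L2)) + pairing _ (star ((hPerp V v N μ φ a : Perp φ) : L2))
      + pairing _ (star ((a : Perp φ) : L2)) = -pairing _ (star ((a : Perp φ) : L2)) at h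
    rw [hp, hp, hp, hp] at h
    rw [fPerp, inner_block_right, Submodule.coe_inner, Submodule.coe_inner, Submodule.coe_inner,
      coe_kPerp_fBarPerp hk hkφ, coe_kPerp hk hkφ, coe_kPerp hk hkφ]
    linear_combination h

theorem hPhBar_conj (hV : ∀ x, 0 ≤ V x)
    (hVloc : LocallyIntegrable V (volume : Measure R3)) (hv : ∀ x, 0 ≤ v x)
    (hvsymm : ∀ x, v (-x) = v x)
    (hvm : AEStronglyMeasurable v (volume : Measure R3)) (hC : ∀ x, v x ≤ C)
    (hk : transposeOp k = k) (hkφ : k (star φ) = 0)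
    {u : Perp φ} (hu : u ∈ (hPh V v N μ φ k).domain) :
    ∃ h : conjPerp φ u ∈ (hPhBar V v N μ φ k).domain,
      hPhBar V v N μ φ k ⟨conjPerp φ u, h⟩ = conjPerp φ (hPh V v N μ φ k ⟨u, hu⟩) := by
  obtain ⟨h, e⟩ := hTPerp_conj hV hVloc hv hvsymm hvm hC (N := N) (μ := μ) (φ := φ) hu
  refine ⟨h, Subtype.ext ?_⟩
  change (kBarPerp φ k (fPerp v N φ (conjPerp φ u)) : L2)
      + (hTPerp V v N μ φ ⟨conjPerp φ u, h⟩ : L2)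
    = star ((kPerp φ k (fBarPerp v N φ u) : L2) + (hPerp V v N μ φ ⟨u, hu⟩ : L2))
  rw [e, coe_kBarPerp_fPerp hk hkφ, coe_kPerp_fBarPerp hk hkφ, star_add_L2, conjOp_apply,
    star_fOp hv hvm hC]
  change star (k (fBarOp v N φ (star (star (u : L2))))) + _ = _
  rw [star_star]
  rfl

theorem hPh_conj (hV : ∀ x, 0 ≤ V x)
    (hVloc : LocallyIntegrable V (volume : Measure R3)) (hv : ∀ x, 0 ≤ v x)
    (hvsymm : ∀ x, v (-x) = v x)
    (hvm : AEStronglyMeasurable v (volume : Measure R3)) (hC : ∀ x, v x ≤ C)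
    (hk : transposeOp k = k) (hkφ : k (star φ) = 0)
    {u : Perp φ} (hu : conjPerp φ u ∈ (hPhBar V v N μ φ k).domain) :
    ∃ h : u ∈ (hPh V v N μ φ k).domain,
      conjPerp φ (hPh V v N μ φ k ⟨u, h⟩) = hPhBar V v N μ φ k ⟨conjPerp φ u, hu⟩ := by
  have h : u ∈ (hPh V v N μ φ k).domain := mem_hPerp_of_conj hV hVloc hv hvm hC hu
  exact ⟨h, (hPhBar_conj hV hVloc hv hvsymm hvm hC hk hkφ h).2.symm⟩

theorem mem_pmapSpectrum_hPhBar (hV : ∀ x, 0 ≤ V x)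
    (hVloc : LocallyIntegrable V (volume : Measure R3)) (hv : ∀ x, 0 ≤ v x)
    (hvsymm : ∀ x, v (-x) = v x)
    (hvm : AEStronglyMeasurable v (volume : Measure R3)) (hC : ∀ x, v x ≤ C)
    (hk : transposeOp k = k) (hkφ : k (star φ) = 0) (z : ℂ) :
    z ∈ pmapSpectrum (hPhBar V v N μ φ k) ↔ conj z ∈ pmapSpectrum (hPh V v N μ φ k) := by
  have h1 : ∀ a (ha : a ∈ (hPh V v N μ φ k).domain),
      ∃ h : (⟨star (a : L2), star_mem_perp a.2⟩ : Perp (star φ)) ∈ (hPhBar V v N μ φ k).domain,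
      (hPhBar V v N μ φ k ⟨_, h⟩ : L2) = star (hPh V v N μ φ k ⟨a, ha⟩ : L2) := fun a ha => by
    obtain ⟨h, e⟩ := hPhBar_conj hV hVloc hv hvsymm hvm hC hk hkφ ha
    exact ⟨h, congrArg Subtype.val e⟩
  have h2 : ∀ b (hb : b ∈ (hPhBar V v N μ φ k).domain),
      ∃ h : (⟨star (b : L2), star_mem_perp' b.2⟩ : Perp φ) ∈ (hPh V v N μ φ k).domain,
      (hPh V v N μ φ k ⟨_, h⟩ : L2) = star (hPhBar V v N μ φ k ⟨b, hb⟩ : L2) := fun b hb => by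
    obtain ⟨b', rfl⟩ := exists_conjPerp b
    obtain ⟨h, e⟩ := hPh_conj hV hVloc hv hvsymm hvm hC hk hkφ hb
    have e1 : (⟨star ((conjPerp φ b' : Perp (star φ)) : L2),
        star_mem_perp' (conjPerp φ b').2⟩ : Perp φ) = b' := Subtype.ext (star_star _)
    rw [← e]
    simp only [e1]
    exact ⟨h, (star_star _).symm⟩
  refine not_congr ⟨?_, ?_⟩
  · rintro ⟨R, hR⟩
    exact hR.conj (fun _ => star_mem_perp') (fun _ => star_mem_perp) h2 h1
  · rintro ⟨R, hR⟩
    rw [← Complex.conj_conj z]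
    exact hR.conj (fun _ => star_mem_perp) (fun _ => star_mem_perp') h1 h2

end BosePair

/-! ### Eigenvectors under intertwining and for diagonal block operators -/

theorem IsEigenvector.map {X Y : Type*} [NormedAddCommGroup X] [NormedSpace ℂ X]
    [NormedAddCommGroup Y] [NormedSpace ℂ Y] {M : X →ₗ.[ℂ] X} {D : Y →ₗ.[ℂ] Y} {W : X →L[ℂ] Y}
    (hinj : Function.Injective W)
    (hW : ∀ x (hx : x ∈ M.domain), ∃ h : W x ∈ D.domain, D ⟨W x, h⟩ = W (M ⟨x, hx⟩))
    {z : ℂ} {x : X} (h : IsEigenvector M z x) : IsEigenvector D z (W x) := by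
  obtain ⟨h0, hx, e⟩ := h
  obtain ⟨hd, e'⟩ := hW x hx
  refine ⟨fun h1 => h0 (hinj (h1.trans (map_zero W).symm)), hd, ?_⟩
  rw [e', e, map_smul]

section Diagonal

variable {X Y : Type*} [NormedAddCommGroup X] [NormedSpace ℂ X] [NormedAddCommGroup Y]
  [NormedSpace ℂ Y] {P : X →ₗ.[ℂ] X} {Q : Y →ₗ.[ℂ] Y} {z : ℂ}

theorem IsEigenvector.neg {x : X} (h : IsEigenvector P z x) : IsEigenvector (-P) (-z) x := by
  obtain ⟨h0, hx, e⟩ := h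
  refine ⟨h0, hx, ?_⟩
  rw [neg_smul, ← e]
  rfl

theorem IsEigenvector.blockPMap_left {x : X} (h : IsEigenvector P z x) :
    IsEigenvector (blockPMap P 0 0 Q) z (x, 0) := by
  obtain ⟨h0, hx, e⟩ := h
  refine ⟨fun h1 => h0 (congrArg Prod.fst h1), ⟨hx, zero_mem _⟩, Prod.ext ?_ ?_⟩
  · exact (add_zero _).trans e
  · exact (zero_add _).trans (Q.map_zero.trans (smul_zero z).symm)

theorem IsEigenvector.blockPMap_right {y : Y} (h : IsEigenvector Q z y) :
    IsEigenvector (blockPMap P 0 0 Q) z (0, y) := by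
  obtain ⟨h0, hx, e⟩ := h
  refine ⟨fun h1 => h0 (congrArg Prod.snd h1), ⟨zero_mem _, hx⟩, Prod.ext ?_ ?_⟩
  · exact (add_zero _).trans (P.map_zero.trans (smul_zero z).symm)
  · exact (zero_add _).trans e

theorem IsEigenvector.of_blockPMap {p : X × Y} (h : IsEigenvector (blockPMap P 0 0 Q) z p) :
    (p.1 ≠ 0 → IsEigenvector P z p.1) ∧ (p.2 ≠ 0 → IsEigenvector Q z p.2) := by
  obtain ⟨-, hp, e⟩ := h
  exact ⟨fun h0 => ⟨h0, hp.1, (add_zero _).symm.trans (congrArg Prod.fst e)⟩,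
    fun h0 => ⟨h0, hp.2, (zero_add _).symm.trans (congrArg Prod.snd e)⟩⟩

end Diagonal

end BoseGas

end

/-! ### Assembly of the block diagonalization, the spectra and the eigenvectors -/

theorem mainTheorem6
    (V v : BoseGas.R3 → ℝ) (N : ℕ) (μ : ℝ) (φ : BoseGas.L2)
    -- the trapping potential
    (hV : ∀ x, 0 ≤ V x) (hVloc : MeasureTheory.LocallyIntegrable V MeasureTheory.volume)
    -- the pair interaction potential
    (hv : ∀ x, 0 ≤ v x) (hvsymm : ∀ x, v (-x) = v x)
    (hvint : MeasureTheory.Integrable v MeasureTheory.volume) (hvbdd : ∃ C, ∀ x, v x ≤ C)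
    -- the condensate
    (hφnorm : ‖φ‖ = 1)
    (hφ : ∃ hdom : φ ∈ (BoseGas.hartreeOp V v N φ).domain,
      BoseGas.hartreeOp V v N φ ⟨φ, hdom⟩ = (μ : ℂ) • φ)
    (c : ℝ) (hc : 0 < c) (hcoer : BoseGas.IsCoerciveWith V v N μ φ c)
    -- the pair-excitation operator
    (k : BoseGas.L2 →L[ℂ] BoseGas.L2)
    (hksymm : BoseGas.transposeOp k = k) (hkφ : k (star φ) = 0) (hknorm : ‖k‖ < 1)
    (hkRic : BoseGas.IsRiccatiSolution V v N μ φ k) :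
    -- `W` is boundedly invertible, with the explicit inverse
    (IsUnit (1 - BoseGas.kPerp φ k ∘L BoseGas.kBarPerp φ k) ∧
      IsUnit (1 - BoseGas.kBarPerp φ k ∘L BoseGas.kPerp φ k) ∧
      BoseGas.wOp φ k ∘L BoseGas.wInvOp φ k = 1 ∧
      BoseGas.wInvOp φ k ∘L BoseGas.wOp φ k = 1) ∧
    -- `D W = W M` as unbounded operators: equal domains and equal values
    ((∀ x, BoseGas.wOp φ k x ∈ (BoseGas.dOp V v N μ φ k).domain ↔
        x ∈ (BoseGas.mOp V v N μ φ).domain) ∧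
      ∀ (x) (hx : x ∈ (BoseGas.mOp V v N μ φ).domain)
        (hWx : BoseGas.wOp φ k x ∈ (BoseGas.dOp V v N μ φ k).domain),
        BoseGas.dOp V v N μ φ k ⟨BoseGas.wOp φ k x, hWx⟩
          = BoseGas.wOp φ k (BoseGas.mOp V v N μ φ ⟨x, hx⟩)) ∧
    -- spectra
    (BoseGas.pmapSpectrum (BoseGas.mOp V v N μ φ)
        = BoseGas.pmapSpectrum (BoseGas.dOp V v N μ φ k) ∧
      BoseGas.pmapSpectrum (BoseGas.dOp V v N μ φ k)
        = BoseGas.pmapSpectrum (BoseGas.hPh V v N μ φ k)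
          ∪ BoseGas.pmapSpectrum (-BoseGas.hPh V v N μ φ k) ∧
      (∀ z ∈ BoseGas.pmapSpectrum (BoseGas.hPh V v N μ φ k), z.im = 0 ∧ 0 < z.re) ∧
      Disjoint (BoseGas.pmapSpectrum (BoseGas.hPh V v N μ φ k))
        (BoseGas.pmapSpectrum (-BoseGas.hPh V v N μ φ k))) ∧
    -- every eigenvector of `h_ph` gives two eigenvectors of `M` through `W⁻¹`
    (∀ (E : ℂ) (ω : BoseGas.Perp φ), BoseGas.IsEigenvector (BoseGas.hPh V v N μ φ k) E ω →
      (BoseGas.IsEigenvector (BoseGas.mOp V v N μ φ) E (BoseGas.wInvOp φ k (ω, 0)) ∧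
        BoseGas.wInvOp φ k (ω, 0)
          = (BoseGas.invKKBar φ k ω, -BoseGas.kBarPerp φ k (BoseGas.invKKBar φ k ω))) ∧
      (BoseGas.IsEigenvector (BoseGas.mOp V v N μ φ) (-E)
          (BoseGas.wInvOp φ k (0, BoseGas.conjPerp φ ω)) ∧
        BoseGas.wInvOp φ k (0, BoseGas.conjPerp φ ω)
          = (-BoseGas.kPerp φ k (BoseGas.invKBarK φ k (BoseGas.conjPerp φ ω)),
              BoseGas.invKBarK φ k (BoseGas.conjPerp φ ω)))) ∧
    -- and every eigenvector of `M` arises in this way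
    (∀ (E : ℂ) (x : BoseGas.Perp φ × BoseGas.Perp (star φ)),
      BoseGas.IsEigenvector (BoseGas.mOp V v N μ φ) E x →
      ∃ ω : BoseGas.Perp φ,
        (BoseGas.IsEigenvector (BoseGas.hPh V v N μ φ k) E ω ∧
          x = BoseGas.wInvOp φ k (ω, 0)) ∨
        (BoseGas.IsEigenvector (BoseGas.hPh V v N μ φ k) (-E) ω ∧
          x = BoseGas.wInvOp φ k (0, BoseGas.conjPerp φ ω))) := by
  obtain ⟨C, hC⟩ := hvbdd
  obtain ⟨hφd, -⟩ := hφ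
  have hvm := hvint.aestronglyMeasurable
  have h := BoseGas.isPairSystem hV hVloc hv hvsymm hvm hC hφnorm hφd hc hcoer hksymm hkφ hknorm
    hkRic
  have hWW' : BoseGas.wOp φ k ∘L BoseGas.wInvOp φ k = 1 := h.blockCLM_comp_inverse
  have hW'W : BoseGas.wInvOp φ k ∘L BoseGas.wOp φ k = 1 := h.inverse_comp_blockCLM
  have hWW'x : ∀ y, BoseGas.wOp φ k (BoseGas.wInvOp φ k y) = y := DFunLike.congr_fun hWW'
  have hW'Wx : ∀ x, BoseGas.wInvOp φ k (BoseGas.wOp φ k x) = x := DFunLike.congr_fun hW'W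
  have hdom : ∀ x, BoseGas.wOp φ k x ∈ (BoseGas.dOp V v N μ φ k).domain ↔
      x ∈ (BoseGas.mOp V v N μ φ).domain := h.mem_domain_iff
  have hDW : ∀ (x) (hx : x ∈ (BoseGas.mOp V v N μ φ).domain)
      (hWx : BoseGas.wOp φ k x ∈ (BoseGas.dOp V v N μ φ k).domain),
      BoseGas.dOp V v N μ φ k ⟨BoseGas.wOp φ k x, hWx⟩
        = BoseGas.wOp φ k (BoseGas.mOp V v N μ φ ⟨x, hx⟩) := h.intertwining
  have hW : ∀ x (hx : x ∈ (BoseGas.mOp V v N μ φ).domain),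
      ∃ hd : BoseGas.wOp φ k x ∈ (BoseGas.dOp V v N μ φ k).domain,
        BoseGas.dOp V v N μ φ k ⟨BoseGas.wOp φ k x, hd⟩
          = BoseGas.wOp φ k (BoseGas.mOp V v N μ φ ⟨x, hx⟩) :=
    fun x hx => ⟨(hdom x).2 hx, hDW x hx _⟩
  have hW' : ∀ y (hy : y ∈ (BoseGas.dOp V v N μ φ k).domain),
      ∃ hd : BoseGas.wInvOp φ k y ∈ (BoseGas.mOp V v N μ φ).domain,
        BoseGas.mOp V v N μ φ ⟨BoseGas.wInvOp φ k y, hd⟩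
          = BoseGas.wInvOp φ k (BoseGas.dOp V v N μ φ k ⟨y, hy⟩) := by
    intro y hy
    obtain ⟨x, rfl⟩ : ∃ x, BoseGas.wOp φ k x = y := ⟨_, hWW'x y⟩
    have hx := (hdom x).1 hy
    rw [hDW x hx hy, hW'Wx]
    simp only [hW'Wx]
    exact ⟨hx, trivial⟩
  have hreal : ∀ z ∈ BoseGas.pmapSpectrum (BoseGas.hPh V v N μ φ k), z.im = 0 ∧ 0 < z.re :=
    fun z hz => h.spectrum_dressedPMap hz
  have hrealBar : ∀ z ∈ BoseGas.pmapSpectrum (BoseGas.hPhBar V v N μ φ k), z.im = 0 ∧ 0 < z.re :=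
    fun z hz => h.swap.spectrum_dressedPMap hz
  -- Conjugation alone relates the two spectra by `z ↦ conj z`; both are real, the second one by
  -- `h.swap`, so they coincide.
  have hbar : BoseGas.pmapSpectrum (BoseGas.hPhBar V v N μ φ k)
      = BoseGas.pmapSpectrum (BoseGas.hPh V v N μ φ k) := by
    ext z
    have key := BoseGas.mem_pmapSpectrum_hPhBar (N := N) (μ := μ) (φ := φ) hV hVloc hv hvsymm hvm
      hC hksymm hkφ z
    constructor
    · intro hz
      rw [← Complex.conj_eq_iff_im.2 (hrealBar z hz).1]
      exact key.1 hz
    · intro hz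
      refine key.2 ?_
      rwa [Complex.conj_eq_iff_im.2 (hreal z hz).1]
  refine ⟨⟨h.isUnit, h.swap.isUnit, hWW', hW'W⟩, ⟨hdom, hDW⟩, ⟨?_, ?_, hreal, ?_⟩, ?_, ?_⟩
  · exact (BoseGas.pmapSpectrum_subset_of_intertwining hW'Wx hW' hW).antisymm
      (BoseGas.pmapSpectrum_subset_of_intertwining hWW'x hW hW')
  · refine (BoseGas.pmapSpectrum_blockPMap_diagonal _ _).trans (congrArg _ ?_)
    ext z
    rw [BoseGas.mem_pmapSpectrum_neg, BoseGas.mem_pmapSpectrum_neg, hbar]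
  · rw [Set.disjoint_left]
    intro z hz hz'
    have h1 := (hreal z hz).2
    have h2 := (hreal _ (BoseGas.mem_pmapSpectrum_neg.1 hz')).2
    rw [Complex.neg_re] at h2
    linarith
  · intro E ω hω
    -- The conjugate of `ω` has eigenvalue `conj E`, which equals `E` because the spectrum is real.
    have hE : conj E = E := Complex.conj_eq_iff_im.2 (hreal E hω.mem_pmapSpectrum).1
    have hinj : Function.Injective (BoseGas.wInvOp φ k) :=
      Function.LeftInverse.injective hWW'x
    have hω' : BoseGas.IsEigenvector (BoseGas.hPhBar V v N μ φ k) E (BoseGas.conjPerp φ ω) := by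
      obtain ⟨h0, hd, e⟩ := hω
      obtain ⟨hd', e'⟩ := BoseGas.hPhBar_conj hV hVloc hv hvsymm hvm hC hksymm hkφ hd
      refine ⟨fun h1 => h0 ?_, hd', ?_⟩
      · refine Subtype.ext ?_
        rw [← star_star (ω : BoseGas.L2)]
        exact (congrArg star (congrArg Subtype.val h1)).trans BoseGas.star_zero_L2
      · rw [e', e]
        refine Subtype.ext ((BoseGas.star_smul_L2 E ω).trans ?_)
        rw [hE]
        rfl
    refine ⟨⟨hω.blockPMap_left.map hinj hW', Prod.ext ?_ ?_⟩,
      hω'.neg.blockPMap_right.map hinj hW', Prod.ext ?_ ?_⟩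
    · change BoseGas.invKKBar φ k ω + -(BoseGas.kPerp φ k (BoseGas.invKBarK φ k 0)) = _
      rw [map_zero, map_zero, neg_zero, add_zero]
    · change -(BoseGas.kBarPerp φ k (BoseGas.invKKBar φ k ω)) + BoseGas.invKBarK φ k 0 = _
      rw [map_zero, add_zero]
    · change BoseGas.invKKBar φ k 0
        + -(BoseGas.kPerp φ k (BoseGas.invKBarK φ k (BoseGas.conjPerp φ ω))) = _
      rw [map_zero, zero_add]
    · change -(BoseGas.kBarPerp φ k (BoseGas.invKKBar φ k 0))
        + BoseGas.invKBarK φ k (BoseGas.conjPerp φ ω) = _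
      rw [map_zero, map_zero, neg_zero, zero_add]
  · intro E x hx
    obtain ⟨h1, h2⟩ := (hx.map (Function.LeftInverse.injective hW'Wx) hW).of_blockPMap
    have hx0 : BoseGas.wOp φ k x ≠ 0 := fun h0 => hx.1 (by rw [← hW'Wx x, h0, map_zero])
    have h2' : (BoseGas.wOp φ k x).2 ≠ 0 →
        BoseGas.IsEigenvector (BoseGas.hPhBar V v N μ φ k) (-E) (BoseGas.wOp φ k x).2 :=
      fun h0 => by simpa only [neg_neg] using (h2 h0).neg
    -- If both components of `W x` were nonzero, `E` and `-E` would both be positive; hence `W x`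
    -- lies in one of the two summands.
    by_cases hb : (BoseGas.wOp φ k x).2 = 0
    · have ha : (BoseGas.wOp φ k x).1 ≠ 0 := fun ha => hx0 (Prod.ext ha hb)
      refine ⟨(BoseGas.wOp φ k x).1, Or.inl ⟨h1 ha, ?_⟩⟩
      conv_lhs => rw [← hW'Wx x]
      exact congrArg _ (Prod.ext rfl hb)
    · have hbe := h2' hb
      have hr := hrealBar _ hbe.mem_pmapSpectrum
      have ha : (BoseGas.wOp φ k x).1 = 0 := by
        by_contra ha
        have := (hreal _ (h1 ha).mem_pmapSpectrum).2
        have hr2 := hr.2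
        rw [Complex.neg_re] at hr2
        linarith
      obtain ⟨ω, hω⟩ := BoseGas.exists_conjPerp (φ := φ) (BoseGas.wOp φ k x).2
      rw [← hω] at hbe
      refine ⟨ω, Or.inr ⟨?_, ?_⟩⟩
      · obtain ⟨h0, hd, e⟩ := hbe
        obtain ⟨hd', e'⟩ := BoseGas.hPh_conj hV hVloc hv hvsymm hvm hC hksymm hkφ hd
        refine ⟨fun h3 => h0 ?_, hd', ?_⟩
        · rw [h3]
          exact Subtype.ext BoseGas.star_zero_L2
        · rw [e] at e'
          have e2 := congrArg (fun s => star (Subtype.val s)) e'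
          refine Subtype.ext ((star_star _).symm.trans (e2.trans ?_))
          refine (BoseGas.star_smul_L2 (-E) _).trans ?_
          rw [Complex.conj_eq_iff_im.2 hr.1]
          exact congrArg _ (star_star (ω : BoseGas.L2))
      · conv_lhs => rw [← hW'Wx x]
        exact congrArg _ (Prod.ext ha hω.symm)
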